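/- Let $\mathcal A$ be a separable unital $C^*$-algebra with a faithful, continuous (positive) trace $\mathcal T_{\mathcal A}:\mathcal A\to\mathbb C$, let $d\in\mathbb N$, and let $\mathbb B$ be the algebra of bounded operators on $\ell^2(\mathbb Z^d)$. Let $\mathcal A\otimes\mathbb B$ be the spatial $C^*$-tensor product, i.e. for a faithful unital representation $\mathcal A\subset B(\mathcal K)$ on a Hilbert space (the statement holds for every such representation), the norm closure in $B(\mathcal K\otimes\ell^2(\mathbb Z^d))$ of the linear span of the operators $a\otimes b$, $a\in\mathcal A$, $b\in\mathbb B$. Each $\hat a\in\mathcal A\otimes\mathbb B$ has matrix entries $a_{xy}\in\mathcal A$, $\hat a=\sum_{x,y\in\mathbb Z^d}a_{xy}\otimes E_{x,y}$. For positive $\hat a\in\mathcal A\otimes\mathbb B$ put $$\widehat{\mathcal T}\{\hat a\}=(\mathcal T_{\mathcal A}\otimes\mathrm{Tr})\{\hat a\}=\sum_{x\in\mathbb Z^d}\mathcal T_{\mathcal A}\{a_{xx}\}\in[0,\infty],$$ and let $$\mathcal S_1=\mathrm{span}\{\hat a\in(\mathcal A\otimes\mathbb B)_+ \mid \widehat{\mathcal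 T}\{\hat a\}<\infty\}.$$ Let $\mathbb S_1\subset\mathbb B$ be the ideal of ordinary trace-class operators, let $\mathcal A\odot\mathbb S_1$ be the linear span of the operators $a\otimes b$ with $a\in\mathcal A$, $b\in\mathbb S_1$, and let $\mathcal A\otimes\mathbb S_1$ be its completion inside $\mathcal A\otimes\mathbb B$ for the trace norm $\|\hat x\|_1=(\mathcal T_{\mathcal A}\otimes\mathrm{Tr})\{|\hat x|\}$, where $|\hat x|=(\hat x^*\hat x)^{1/2}$; that is, $$\mathcal A\otimes\mathbb S_1=\{\hat a\in\mathcal A\otimes\mathbb B \mid \forall\,\varepsilon>0\ \exists\,\hat y\in\mathcal A\odot\mathbb S_1:\ \widehat{\mathcal T}\{|\hat a-\hat y|\}<\varepsilon\}.$$ Then $$\mathcal S_1=\mathcal A\otimes\mathbb S_1 .$$ -/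

import Mathlib

open scoped ENNReal ComplexOrder

noncomputable section

namespace SpatialTrace

/-- The Hilbert space `K ⊗ ℓ²(ι)`, realized as the space of square-summable families in `K`
indexed by `ι`: the vector `k ⊗ δ_y` is the family `lp.single 2 y k`. -/
abbrev L2 (ι K : Type*) [NormedAddCommGroup K] : Type _ := lp (fun _ : ι => K) 2

/-- The absolute value `|T| = (T* T)^{1/2}` of a bounded operator on a Hilbert space. -/
def absOp {H : Type*} [NormedAddCommGroup H] [InnerProductSpace ℂ H] [CompleteSpace H]
    (T : H →L[ℂ] H) : H →L[ℂ] H := CFC.abs T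

variable {ι : Type*} [DecidableEq ι]
variable {K : Type*} [NormedAddCommGroup K] [InnerProductSpace ℂ K]

/-- The matrix entry `b_{xy} = ⟨δ_x, b δ_y⟩` of a bounded operator `b` on `ℓ²(ι)`. -/
def coef (b : L2 ι ℂ →L[ℂ] L2 ι ℂ) (x y : ι) : ℂ := b (lp.single 2 y (1 : ℂ)) x

theorem amplify_finite (b : L2 ι ℂ →L[ℂ] L2 ι ℂ) (S T : Finset ι) (v : ι → K) :
    ∑ x ∈ S, ‖∑ y ∈ T, coef b x y • v y‖ ^ 2 ≤ ‖b‖ ^ 2 * ∑ y ∈ T, ‖v y‖ ^ 2 := by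
  classical
  let W : Submodule ℂ K := Submodule.span ℂ (T.image v : Set K)
  have : FiniteDimensional ℂ W := FiniteDimensional.span_finset ℂ (T.image v)
  let e := stdOrthonormalBasis ℂ W
  have hv : ∀ y ∈ T, v y ∈ W := fun y hy =>
    Submodule.subset_span (by simpa using ⟨y, hy, rfl⟩)
  let w : ι → W := fun y => if h : v y ∈ W then ⟨v y, h⟩ else 0
  have hw : ∀ y ∈ T, (w y : K) = v y := fun y hy => by simp [w, hv y hy]
  let h : Fin (Module.finrank ℂ W) → L2 ι ℂ := fun i =>
    ∑ y ∈ T, (inner ℂ (e i) (w y)) • lp.single 2 y (1 : ℂ)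
  have hb : ∀ i x, b (h i) x = inner ℂ (e i) (∑ y ∈ T, coef b x y • w y) := by
    intro i x
    simp only [h, map_sum, map_smul, inner_sum, inner_smul_right, lp.coeFn_sum, Finset.sum_apply,
      lp.coeFn_smul, Pi.smul_apply, coef, smul_eq_mul]
    exact Finset.sum_congr rfl fun y _ => mul_comm _ _
  have hpars : ∀ u : W, ‖u‖ ^ 2 = ∑ i, ‖(inner ℂ (e i) u : ℂ)‖ ^ 2 := fun u =>
    (e.sum_sq_norm_inner_right u).symm
  have hL : ∀ x, ‖∑ y ∈ T, coef b x y • v y‖ ^ 2 = ∑ i, ‖b (h i) x‖ ^ 2 := by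
    intro x
    have : ∑ y ∈ T, coef b x y • v y = ((∑ y ∈ T, coef b x y • w y : W) : K) := by
      push_cast
      exact Finset.sum_congr rfl fun y hy => by rw [hw y hy]
    rw [this]
    simp only [hb]
    exact hpars _
  have hh : ∀ i, ‖h i‖ ^ 2 = ∑ y ∈ T, ‖(inner ℂ (e i) (w y) : ℂ)‖ ^ 2 := by
    intro i
    have h1 := lp.norm_sum_single (p := 2) (E := fun _ : ι => ℂ) (by norm_num)
      (fun y => (inner ℂ (e i) (w y) : ℂ)) T
    have h2 : h i = ∑ y ∈ T, lp.single 2 y (inner ℂ (e i) (w y) : ℂ) := by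
      refine Finset.sum_congr rfl fun y _ => ?_
      rw [← lp.single_smul]; simp
    rw [h2]
    simpa using h1
  have hS : ∀ i, ∑ x ∈ S, ‖b (h i) x‖ ^ 2 ≤ ‖b (h i)‖ ^ 2 := by
    intro i
    simpa using lp.sum_rpow_le_norm_rpow (p := 2) (by norm_num) (b (h i)) S
  calc ∑ x ∈ S, ‖∑ y ∈ T, coef b x y • v y‖ ^ 2
      = ∑ i, ∑ x ∈ S, ‖b (h i) x‖ ^ 2 := by
        rw [Finset.sum_comm]; exact Finset.sum_congr rfl fun x _ => hL x
    _ ≤ ∑ i, ‖b‖ ^ 2 * ‖h i‖ ^ 2 := by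
        refine Finset.sum_le_sum fun i _ => (hS i).trans ?_
        rw [← mul_pow]
        gcongr
        exact b.le_opNorm _
    _ = ‖b‖ ^ 2 * ∑ y ∈ T, ‖v y‖ ^ 2 := by
        rw [← Finset.mul_sum]
        simp only [hh]
        rw [Finset.sum_comm]
        congr 1
        refine Finset.sum_congr rfl fun y hy => ?_
        rw [← hpars, ← hw y hy]
        rfl

theorem summable_coef_smul [CompleteSpace K] (b : L2 ι ℂ →L[ℂ] L2 ι ℂ) (v : L2 ι K) (x : ι) :
    Summable fun y => coef b x y • v y := by
  have hc : ∀ y, ‖coef b x y‖ = ‖(ContinuousLinearMap.adjoint b (lp.single 2 x (1 : ℂ))) y‖ := by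
    intro y
    have h1 : coef b x y = inner ℂ (lp.single 2 x (1 : ℂ)) (b (lp.single 2 y (1 : ℂ))) := by
      rw [lp.inner_single_left]; simp [coef]
    rw [h1, ← ContinuousLinearMap.adjoint_inner_left, lp.inner_single_right]
    simp
  have s1 := (lp.memℓp (ContinuousLinearMap.adjoint b (lp.single 2 x (1 : ℂ)))).summable
    (by norm_num)
  have s2 := (lp.memℓp v).summable (by norm_num)
  refine Summable.of_norm_bounded (s1.add s2) fun y => ?_
  rw [norm_smul, hc]
  simp only [ENNReal.toReal_ofNat, Real.rpow_ofNat]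
  nlinarith [sq_nonneg (‖(ContinuousLinearMap.adjoint b (lp.single 2 x (1 : ℂ))) y‖ - ‖v y‖),
    sq_nonneg ‖(ContinuousLinearMap.adjoint b (lp.single 2 x (1 : ℂ))) y‖, sq_nonneg ‖v y‖]

theorem amplify_bound [CompleteSpace K] (b : L2 ι ℂ →L[ℂ] L2 ι ℂ) (v : L2 ι K) (S : Finset ι) :
    ∑ x ∈ S, ‖∑' y, coef b x y • v y‖ ^ (2 : ℝ≥0∞).toReal
      ≤ (‖b‖ * ‖v‖) ^ (2 : ℝ≥0∞).toReal := by
  simp only [ENNReal.toReal_ofNat, Real.rpow_ofNat]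
  have ht : Filter.Tendsto (fun T : Finset ι => ∑ x ∈ S, ‖∑ y ∈ T, coef b x y • v y‖ ^ 2)
      Filter.atTop (nhds (∑ x ∈ S, ‖∑' y, coef b x y • v y‖ ^ 2)) :=
    tendsto_finsetSum _ fun x _ => ((summable_coef_smul b v x).hasSum.norm).pow 2
  refine le_of_tendsto ht (Filter.Eventually.of_forall fun T => ?_)
  refine (amplify_finite b S T v).trans ?_
  rw [mul_pow]
  gcongr
  simpa using lp.sum_rpow_le_norm_rpow (p := 2) (by norm_num) v T

/-- The operator `1 ⊗ b` on `K ⊗ ℓ²(ι)`, acting by `((1 ⊗ b) v)_x = ∑_y b_{xy} v_y`. -/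
def amplify (K : Type*) [NormedAddCommGroup K] [InnerProductSpace ℂ K] [CompleteSpace K]
    (b : L2 ι ℂ →L[ℂ] L2 ι ℂ) : L2 ι K →L[ℂ] L2 ι K :=
  LinearMap.mkContinuous
    { toFun := fun v => ⟨fun x => ∑' y, coef b x y • v y, memℓp_gen' (amplify_bound b v)⟩
      map_add' := fun v w => by
        ext x
        simp only [lp.coeFn_add, Pi.add_apply, smul_add]
        exact (summable_coef_smul b v x).tsum_add (summable_coef_smul b w x)
      map_smul' := fun c v => by
        ext x
        simp only [lp.coeFn_smul, Pi.smul_apply, RingHom.id_apply, smul_comm _ c]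
        exact (summable_coef_smul b v x).tsum_const_smul c }
    ‖b‖
    fun v => lp.norm_le_of_forall_sum_le (by norm_num) (by positivity) (amplify_bound b v)

/-- The `(x, y)` entry of an operator on `K ⊗ ℓ²(ι)`, an operator on `K`:
`k ↦ (X (k ⊗ δ_y))_x`. -/
def block (X : L2 ι K →L[ℂ] L2 ι K) (x y : ι) : K →L[ℂ] K :=
  (lp.evalCLM ℂ (fun _ : ι => K) 2 x).comp
    (X.comp (lp.singleContinuousLinearMap ℂ (fun _ : ι => K) 2 y))

theorem block_apply (X : L2 ι K →L[ℂ] L2 ι K) (x y : ι) (k : K) :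
    block X x y k = X (lp.single 2 y k) x := rfl

variable [CompleteSpace K]

/-- The operator `T ⊗ b` on `K ⊗ ℓ²(ι)`: first `1 ⊗ b`, then `T` in every coordinate. -/
def tensorOp (T : K →L[ℂ] K) (b : L2 ι ℂ →L[ℂ] L2 ι ℂ) : L2 ι K →L[ℂ] L2 ι K :=
  (lp.mapCLM 2 (fun _ : ι => T) (norm_nonneg T) (fun _ => le_rfl)).comp (amplify K b)

theorem block_tensorOp (T : K →L[ℂ] K) (b : L2 ι ℂ →L[ℂ] L2 ι ℂ) (x y : ι) :
    block (tensorOp T b) x y = coef b x y • T := by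
  ext k
  rw [block_apply]
  change T (∑' z, coef b x z • (lp.single 2 y k : L2 ι K) z) = _
  rw [tsum_eq_single y]
  · simp
  · intro z hz
    rw [lp.single_apply_ne _ _ _ hz, smul_zero]

variable {A : Type*} [CStarAlgebra A]

/-- The spatial tensor product `A ⊗ 𝔹`, with `𝔹` the bounded operators on `ℓ²(ι)` and `A`
represented on `K` by `π`: the norm closure in the bounded operators on `K ⊗ ℓ²(ι)` of the
linear span of the operators `π a ⊗ b`. -/
def spatialTensor (ι : Type*) [DecidableEq ι] (π : A →⋆ₐ[ℂ] (K →L[ℂ] K)) :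
    Submodule ℂ (L2 ι K →L[ℂ] L2 ι K) :=
  (Submodule.span ℂ {X | ∃ (a : A) (b : L2 ι ℂ →L[ℂ] L2 ι ℂ),
    X = tensorOp (π a) b}).topologicalClosure

/-- The matrix entry `a_{xy} ∈ A` of an element `X = ∑ a_{xy} ⊗ E_{xy}` of `A ⊗ 𝔹`: the element
of `A` that `π` maps to the `(x, y)` entry of `X`, see `map_entry`. (Only used for `X` in `A ⊗ 𝔹`
and `π` injective.) -/
def entry (π : A →⋆ₐ[ℂ] (K →L[ℂ] K)) (X : L2 ι K →L[ℂ] L2 ι K) (x y : ι) : A :=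
  Function.invFun π (block X x y)

theorem map_entry (π : A →⋆ₐ[ℂ] (K →L[ℂ] K)) (hπ : Function.Injective π)
    {X : L2 ι K →L[ℂ] L2 ι K} (hX : X ∈ spatialTensor ι π) (x y : ι) :
    π (entry π X x y) = block X x y := by
  refine Function.invFun_eq ?_
  let B : (L2 ι K →L[ℂ] L2 ι K) →ₗ[ℂ] (K →L[ℂ] K) :=
    { toFun := fun X => block X x y
      map_add' := fun _ _ => rfl
      map_smul' := fun _ _ => rfl }
  have hB : Continuous B :=
    continuous_const.clm_comp (continuous_id.clm_comp continuous_const)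
  have hclosed : IsClosed (Set.range π) :=
    (NonUnitalStarAlgHom.isometry π hπ).isClosedEmbedding.isClosed_range
  let R : Submodule ℂ (K →L[ℂ] K) := LinearMap.range (π.toAlgHom.toLinearMap)
  have hle : Submodule.span ℂ {X | ∃ (a : A) (b : L2 ι ℂ →L[ℂ] L2 ι ℂ),
      X = tensorOp (π a) b} ≤ R.comap B := by
    rw [Submodule.span_le]
    rintro _ ⟨a, b, rfl⟩
    refine ⟨coef b x y • a, ?_⟩
    change π (coef b x y • a) = block (tensorOp (π a) b) x y
    rw [block_tensorOp, map_smul]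
  have hcl : IsClosed (R.comap B : Set (L2 ι K →L[ℂ] L2 ι K)) := by
    have := hclosed.preimage hB
    exact this
  exact Submodule.topologicalClosure_minimal _ hle hcl hX

/-- A faithful (positive) trace; continuity is part of the type `A →L[ℂ] ℂ`. -/
structure IsFaithfulTrace (τ : A →L[ℂ] ℂ) : Prop where
  nonneg : ∀ a : A, 0 ≤ τ (star a * a)
  mul_comm : ∀ a b : A, τ (a * b) = τ (b * a)
  faithful : ∀ a : A, τ (star a * a) = 0 → a = 0

/-- The trace `T̂ = τ ⊗ Tr` on the positive cone of `A ⊗ 𝔹`, `T̂(X) = ∑_x τ(X_{xx}) ∈ [0, ∞]`. -/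
def hatTrace (τ : A →L[ℂ] ℂ) (π : A →⋆ₐ[ℂ] (K →L[ℂ] K)) (X : L2 ι K →L[ℂ] L2 ι K) : ℝ≥0∞ :=
  ∑' x, ENNReal.ofReal (τ (entry π X x x)).re

/-- The trace-class elements of `T̂`: the span of the positive elements of `A ⊗ 𝔹` with finite
trace. -/
def traceClassElements (ι : Type*) [DecidableEq ι] (τ : A →L[ℂ] ℂ) (π : A →⋆ₐ[ℂ] (K →L[ℂ] K)) :
    Submodule ℂ (L2 ι K →L[ℂ] L2 ι K) :=
  Submodule.span ℂ {X | X ∈ spatialTensor ι π ∧ X.IsPositive ∧ hatTrace τ π X < ∞}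

/-- The ordinary trace-class operators `b` on `ℓ²(ι)`: `Tr |b| = ∑_x ⟨δ_x, |b| δ_x⟩ < ∞`. -/
def IsTraceClass (b : L2 ι ℂ →L[ℂ] L2 ι ℂ) : Prop :=
  Summable fun x => (coef (absOp b) x x).re

/-- The algebraic tensor product `A ⊙ 𝕊₁`: the span of the operators `π a ⊗ b` with `b` an
ordinary trace-class operator. -/
def algTensorTraceClass (ι : Type*) [DecidableEq ι] (π : A →⋆ₐ[ℂ] (K →L[ℂ] K)) :
    Submodule ℂ (L2 ι K →L[ℂ] L2 ι K) :=
  Submodule.span ℂ {X | ∃ (a : A) (b : L2 ι ℂ →L[ℂ] L2 ι ℂ),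
    IsTraceClass b ∧ X = tensorOp (π a) b}

/-- The tensor product `A ⊗ 𝕊₁`, completed inside `A ⊗ 𝔹` for the trace norm
`‖X‖₁ = (τ ⊗ Tr)(|X|)`: the elements of `A ⊗ 𝔹` that are trace-norm limits of elements of
`A ⊙ 𝕊₁`. -/
def tensorTraceClass (ι : Type*) [DecidableEq ι] (τ : A →L[ℂ] ℂ) (π : A →⋆ₐ[ℂ] (K →L[ℂ] K)) :
    Set (L2 ι K →L[ℂ] L2 ι K) :=
  {X | X ∈ spatialTensor ι π ∧ ∀ ε : ℝ, 0 < ε →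
    ∃ Y ∈ algTensorTraceClass ι π, hatTrace τ π (absOp (X - Y)) < ENNReal.ofReal ε}

end SpatialTrace

end

set_option linter.unusedSectionVars false

noncomputable section

namespace SpatialTrace

/-! ### Domination and trace estimates in an abstract C*-algebra -/

section Abstract

open Filter Topology

variable {B : Type*} [CStarAlgebra B] [PartialOrder B] [StarOrderedRing B]

/-! The trace norm is awkward to handle directly: its triangle inequality usually goes through a
polar decomposition, whose partial isometry need not lie in the C*-algebra. It is replaced by order
domination: `HasBound M T Z r` says that the 2×2 matrix with rows (C, Z*) and (Z, D) is positive, in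
the sense of `Dominated`, for some positive C, D with T(C) + T(D) ≤ r. Such bounds visibly add and
scale, and any factorization Z = VW gives one, with C = W*W and D = VV*.

Domination is equivalent to trace-norm control up to a factor 2. `HasBound.trace_abs_le` tests it on
contractions V_n with V_n*Z → |Z|. Conversely `exists_polar_factorization` writes Z = VW inside the
algebra with V*V = W*W = |Z|. Finally, `HasBound.mem_span` shows that a finite bound puts Z in the
span of the positive elements of finite trace.

All this needs only that T is an additive, homogeneous, lower semicontinuous trace on the positive
cone. For τ ⊗ Tr (`isConeTrace_hatTrace`) the crux is that columns of elements of A ⊗ 𝔹 are norm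
limits of their finite parts, so (X*X)_{xx} = ∑_y X_{yx}* X_{yx} converges in norm and τ passes
through the sum.

If X is within finite trace norm of some Y in A ⊙ 𝕊₁, then X − Y and Y have finite bounds, hence so
does X, and X is in 𝒮₁. If X = R² ≥ 0 has finite trace, its finite corners PXP lie in A ⊙ 𝕊₁, and X
− PXP factors through R and (1 − P)R; the trace of (1 − P)X(1 − P) is the tail of a convergent
series, so a weighted Cauchy–Schwarz bound makes the error small. -/

theorem cfc_real_mem {M : StarSubalgebra ℂ B} (hM : IsClosed (M : Set B)) (f : ℝ → ℝ) {a : B}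
    (ha : a ∈ M) : cfc f a ∈ M :=
  cfc_mem (𝕜' := ℂ) (hs := hM) f ha

theorem sqrt_mem {M : StarSubalgebra ℂ B} (hM : IsClosed (M : Set B)) {a : B} (ha : a ∈ M)
    (h0 : 0 ≤ a) : CFC.sqrt a ∈ M := by
  rw [CFC.sqrt_eq_real_sqrt a h0]
  exact cfcₙ_mem (𝕜' := ℂ) (hs := hM) Real.sqrt ha

theorem exists_star_mul_self_eq {M : StarSubalgebra ℂ B} (hM : IsClosed (M : Set B)) {a : B}
    (ha : a ∈ M) (h0 : 0 ≤ a) : ∃ r ∈ M, star r = r ∧ r * r = a :=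
  ⟨CFC.sqrt a, sqrt_mem hM ha h0, (CFC.sqrt_nonneg a).isSelfAdjoint.star_eq,
    CFC.sqrt_mul_sqrt_self a h0⟩

theorem abs_eq_of_mul_self_eq {a b : B} (h : b * b = star a * a) (hb : 0 ≤ b) : CFC.abs a = b :=
  CFC.sqrt_unique h hb

theorem abs_mem {M : StarSubalgebra ℂ B} (hM : IsClosed (M : Set B)) {a : B} (ha : a ∈ M) :
    CFC.abs a ∈ M :=
  sqrt_mem hM (mul_mem (star_mem ha) ha) (star_mul_self_nonneg a)

/-- A lower semicontinuous trace on the positive cone of a star subalgebra `M`. -/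
structure IsConeTrace (M : StarSubalgebra ℂ B) (T : B → ℝ≥0∞) : Prop where
  add : ∀ X ∈ M, ∀ Y ∈ M, 0 ≤ X → 0 ≤ Y → T (X + Y) = T X + T Y
  smul : ∀ X ∈ M, 0 ≤ X → ∀ c : ℝ, 0 ≤ c → T ((c : ℂ) • X) = ENNReal.ofReal c * T X
  lsc : ∀ (X : ℕ → B) (Y : B) (r : ℝ≥0∞), (∀ n, X n ∈ M) → Y ∈ M → (∀ n, T (X n) ≤ r) →
    Tendsto X atTop (𝓝 Y) → T Y ≤ r
  star_mul_self : ∀ X ∈ M, T (star X * X) = T (X * star X)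

variable {M : StarSubalgebra ℂ B} {T : B → ℝ≥0∞}

theorem IsConeTrace.mono (hT : IsConeTrace M T) {X Y : B} (hX : X ∈ M) (hY : Y ∈ M)
    (h0 : 0 ≤ X) (h : X ≤ Y) : T X ≤ T Y := by
  have := hT.add X hX (Y - X) (sub_mem hY hX) h0 (sub_nonneg.2 h)
  rw [add_sub_cancel] at this
  rw [this]
  exact le_self_add

/-- With D = R², traciality turns V*DV = (RV)*(RV) into R(VV*)R, which lies below R² because VV* ≤
1. -/
theorem IsConeTrace.conjugate_le (hM : IsClosed (M : Set B)) (hT : IsConeTrace M T) {D V : B}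
    (hD : D ∈ M) (hV : V ∈ M) (h0 : 0 ≤ D) (h : ‖V‖ ≤ 1) : T (star V * D * V) ≤ T D := by
  obtain ⟨R, hRM, hRs, hRR⟩ := exists_star_mul_self_eq hM hD h0
  have hVV : V * star V ≤ 1 := by
    rw [← CStarAlgebra.norm_le_one_iff_of_nonneg _ (mul_star_self_nonneg V),
      CStarRing.norm_self_mul_star]
    nlinarith [norm_nonneg V]
  have h1 : star V * D * V = star (R * V) * (R * V) := by
    rw [star_mul, hRs, ← hRR]; noncomm_ring
  have h2 : R * V * star (R * V) = star R * (V * star V) * R := by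
    rw [star_mul, hRs]; noncomm_ring
  have h3 : star R * (V * star V) * R ≤ D := by
    refine (star_left_conjugate_le_conjugate hVV R).trans_eq ?_
    rw [mul_one, hRs, hRR]
  rw [h1, hT.star_mul_self _ (mul_mem hRM hV), h2]
  refine hT.mono ?_ hD (star_left_conjugate_nonneg (mul_star_self_nonneg V) R) h3
  exact mul_mem (mul_mem (star_mem hRM) (mul_mem hV (star_mem hV))) hRM

theorem star_mul_cfc_abs_mul_self (Z : B) {f : ℝ → ℝ} (hf : Continuous f) :
    star (Z * cfc f (CFC.abs Z)) * (Z * cfc f (CFC.abs Z)) =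
      cfc (fun s => s * f s) (CFC.abs Z) * cfc (fun s => s * f s) (CFC.abs Z) := by
  set W := CFC.abs Z with hW
  have hWs : IsSelfAdjoint W := (CFC.abs_nonneg Z).isSelfAdjoint
  have hWW : W * W = star Z * Z := CFC.abs_mul_abs Z
  have hfs : star (cfc f W) = cfc f W := (cfc_predicate f W : IsSelfAdjoint _).star_eq
  have h1 := cfc_mul f (fun s => s) W hf.continuousOn continuousOn_id
  have h2 := cfc_mul (fun s => s) f W continuousOn_id hf.continuousOn
  rw [cfc_id' ℝ W hWs] at h1 h2
  have h3 : cfc f W * W = cfc (fun s => s * f s) W := by simp only [← h1, mul_comm]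
  rw [star_mul, hfs]
  calc _ = cfc f W * (star Z * Z) * cfc f W := by noncomm_ring
    _ = (cfc f W * W) * (W * cfc f W) := by rw [← hWW]; noncomm_ring
    _ = _ := by rw [h3, h2]

/-- Reduces norm estimates on Z f(|Z|) to scalar estimates of s f(s) on the spectrum of |Z|. -/
theorem norm_mul_cfc_abs (Z : B) {f : ℝ → ℝ} (hf : Continuous f) :
    ‖Z * cfc f (CFC.abs Z)‖ = ‖cfc (fun s => s * f s) (CFC.abs Z)‖ := by
  have h1 := CStarRing.norm_star_mul_self (x := Z * cfc f (CFC.abs Z))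
  have h2 := CStarRing.norm_star_mul_self (x := cfc (fun s => s * f s) (CFC.abs Z))
  rw [(cfc_predicate (fun s => s * f s) (CFC.abs Z) : IsSelfAdjoint _).star_eq] at h2
  rw [star_mul_cfc_abs_mul_self Z hf, h2] at h1
  exact (mul_self_inj (norm_nonneg _) (norm_nonneg _)).1 h1.symm

/-- `Z` is dominated by the pair `C`, `D`: `(1, -V)* [[C, Z*], [Z, D]] (1, -V)` is positive for
every `V`. -/
def Dominated (Z C D : B) : Prop :=
  ∀ V : B, star V * Z + star Z * V ≤ C + star V * D * V

theorem Dominated.add {Z C D Z' C' D' : B} (h : Dominated Z C D) (h' : Dominated Z' C' D') :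
    Dominated (Z + Z') (C + C') (D + D') := fun V => by
  have := add_le_add (h V) (h' V)
  simp only [star_add, mul_add, add_mul]
  convert this using 1 <;> abel

/-- Substitute c̄V for V; the scalar is absorbed by D alone. -/
theorem Dominated.smul {Z C D : B} (h : Dominated Z C D) (c : ℂ) :
    Dominated (c • Z) C (((‖c‖ ^ 2 : ℝ) : ℂ) • D) := fun V => by
  have := h (star c • V)
  have hc : c * star c = ((‖c‖ ^ 2 : ℝ) : ℂ) := by
    simpa using Complex.mul_conj' c
  simp only [star_smul, star_star, smul_mul_assoc, mul_smul_comm, smul_smul] at this ⊢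
  rw [mul_comm (star c), hc] at this
  exact this

/-- Expand the square (W − V*U)*(W − V*U) ≥ 0. -/
theorem dominated_mul (V W : B) : Dominated (V * W) (star W * W) (V * star V) := fun U => by
  have := star_mul_self_nonneg (W - star V * U)
  rw [← sub_nonneg]
  convert this using 1
  simp only [star_sub, star_mul, star_star]
  noncomm_ring

/-- `Z` is dominated by a pair of elements of the cone with total trace at most `r`. -/
def HasBound (M : StarSubalgebra ℂ B) (T : B → ℝ≥0∞) (Z : B) (r : ℝ≥0∞) : Prop :=
  ∃ C ∈ M, ∃ D ∈ M, 0 ≤ C ∧ 0 ≤ D ∧ Dominated Z C D ∧ T C + T D ≤ r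

theorem HasBound.mono {Z : B} {r r' : ℝ≥0∞} (h : HasBound M T Z r) (hr : r ≤ r') :
    HasBound M T Z r' := by
  obtain ⟨C, hC, D, hD, h1, h2, h3, h4⟩ := h
  exact ⟨C, hC, D, hD, h1, h2, h3, h4.trans hr⟩

theorem HasBound.add (hT : IsConeTrace M T) {Z Z' : B} {r r' : ℝ≥0∞} (h : HasBound M T Z r)
    (h' : HasBound M T Z' r') : HasBound M T (Z + Z') (r + r') := by
  obtain ⟨C, hC, D, hD, h1, h2, h3, h4⟩ := h
  obtain ⟨C', hC', D', hD', h1', h2', h3', h4'⟩ := h'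
  refine ⟨C + C', add_mem hC hC', D + D', add_mem hD hD', add_nonneg h1 h1', add_nonneg h2 h2',
    h3.add h3', ?_⟩
  rw [hT.add _ hC _ hC' h1 h1', hT.add _ hD _ hD' h2 h2', add_add_add_comm]
  exact add_le_add h4 h4'

theorem HasBound.smul (hT : IsConeTrace M T) {Z : B} {r : ℝ≥0∞} (h : HasBound M T Z r) (c : ℂ) :
    HasBound M T (c • Z) ((1 + ENNReal.ofReal (‖c‖ ^ 2)) * r) := by
  obtain ⟨C, hC, D, hD, h1, h2, h3, h4⟩ := h
  refine ⟨C, hC, _, SMulMemClass.smul_mem _ hD, h1, ?_, h3.smul c, ?_⟩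
  · exact smul_nonneg (Complex.zero_le_real.2 (sq_nonneg _)) h2
  · rw [hT.smul _ hD h2 _ (sq_nonneg _)]
    have hC' : T C ≤ r := le_self_add.trans h4
    have hD' : T D ≤ r := le_add_self.trans h4
    rw [add_mul, one_mul]
    gcongr

theorem HasBound.mul {V W : B} (hV : V ∈ M) (hW : W ∈ M) :
    HasBound M T (V * W) (T (star W * W) + T (V * star V)) :=
  ⟨_, mul_mem (star_mem hW) hW, _, mul_mem hV (star_mem hV), star_mul_self_nonneg W,
    mul_star_self_nonneg V, dominated_mul V W, le_rfl⟩

theorem norm_cfc_sub_le {W : B} (hW : 0 ≤ W) {f g : ℝ → ℝ} (hf : Continuous f)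
    (hg : Continuous g) {c : ℝ} (h : ∀ s, 0 ≤ s → |f s - g s| ≤ c) :
    ‖cfc f W - cfc g W‖ ≤ c := by
  rw [← cfc_sub f g W (by fun_prop) (by fun_prop)]
  refine norm_cfc_le ((abs_nonneg _).trans (h 0 le_rfl)) fun x hx => h x ?_
  exact spectrum_nonneg_of_nonneg hW hx

/-- The contractions V_n = Z h_n(|Z|), with h_n a regularization of 1/s, stand in for the polar
partial isometry. Domination at V_n bounds the trace of V_n*Z, and V_n*Z → |Z| in norm, so lower
semicontinuity concludes. -/
theorem HasBound.trace_abs_le (hM : IsClosed (M : Set B)) (hT : IsConeTrace M T) {Z : B}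
    (hZ : Z ∈ M) {r : ℝ≥0∞} (h : HasBound M T Z r) : T (CFC.abs Z) ≤ r := by
  obtain ⟨C, hC, D, hD, hC0, hD0, hdom, hr⟩ := h
  set W := CFC.abs Z with hW
  have hW0 : 0 ≤ W := CFC.abs_nonneg Z
  have hWM : W ∈ M := abs_mem hM hZ
  have hWW : W * W = star Z * Z := CFC.abs_mul_abs Z
  let δ : ℕ → ℝ := fun n => 1 / ((n : ℝ) + 1)
  have hδ : ∀ n, 0 < δ n := fun n => Nat.one_div_pos_of_nat
  let h : ℕ → ℝ → ℝ := fun n s => (max s (δ n))⁻¹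
  have hpos : ∀ n s, 0 < max s (δ n) := fun n s => lt_max_of_lt_right (hδ n)
  have hc : ∀ n, Continuous (h n) := fun n =>
    (continuous_id.max continuous_const).inv₀ fun s => (hpos n s).ne'
  let V : ℕ → B := fun n => Z * cfc (h n) W
  have hVM : ∀ n, V n ∈ M := fun n => mul_mem hZ (cfc_real_mem hM _ hWM)
  have hV1 : ∀ n, ‖V n‖ ≤ 1 := fun n => by
    rw [norm_mul_cfc_abs Z (hc n)]
    refine norm_cfc_le zero_le_one fun s hs => ?_
    have hs0 : 0 ≤ s := spectrum_nonneg_of_nonneg hW0 hs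
    rw [Real.norm_eq_abs, abs_of_nonneg (mul_nonneg hs0 (inv_nonneg.2 (hpos n s).le)),
      ← div_eq_mul_inv, div_le_one (hpos n s)]
    exact le_max_left _ _
  let Y : ℕ → B := fun n => cfc (fun s => h n s * (s * s)) W
  have hYeq : ∀ n, Y n = star (V n) * Z := fun n => by
    have hs : star (cfc (h n) W) = cfc (h n) W := (cfc_predicate (h n) W : IsSelfAdjoint _).star_eq
    have := hc n
    simp only [Y, V]
    rw [cfc_mul (h n) (fun s => s * s) W (by fun_prop) (by fun_prop),
      cfc_mul (fun s => s) (fun s => s) W, cfc_id' ℝ W, hWW, star_mul, hs, mul_assoc]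
  have hY0 : ∀ n, 0 ≤ Y n := fun n => cfc_nonneg fun s _ =>
    mul_nonneg (inv_nonneg.2 (hpos n s).le) (mul_self_nonneg s)
  have hYM : ∀ n, Y n ∈ M := fun n => cfc_real_mem hM _ hWM
  refine hT.lsc Y W r hYM hWM (fun n => ?_) ?_
  · have hle : Y n ≤ C + star (V n) * D * V n := by
      refine le_trans ?_ (hdom (V n))
      have : star Z * V n = Y n := by
        rw [← (hY0 n).isSelfAdjoint.star_eq, hYeq, star_mul, star_star]
      rw [this, ← hYeq]
      -- Domination bounds Y_n + Y_n; one copy is discarded.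
      exact le_add_of_nonneg_left (hY0 n)
    have hm : star (V n) * D * V n ∈ M := mul_mem (mul_mem (star_mem (hVM n)) hD) (hVM n)
    calc T (Y n) ≤ T (C + star (V n) * D * V n) := hT.mono (hYM n) (add_mem hC hm) (hY0 n) hle
      _ = T C + T (star (V n) * D * V n) :=
        hT.add _ hC _ hm hC0 (star_left_conjugate_nonneg hD0 _)
      _ ≤ T C + T D := by
        gcongr
        exact hT.conjugate_le hM hD (hVM n) hD0 (hV1 n)
      _ ≤ r := hr
  · rw [tendsto_iff_norm_sub_tendsto_zero]
    refine squeeze_zero (fun _ => norm_nonneg _) (fun n => ?_)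
      (tendsto_one_div_add_atTop_nhds_zero_nat (𝕜 := ℝ))
    have h1 := norm_cfc_sub_le hW0 (f := fun s => h n s * (s * s)) (g := fun s => s) (c := δ n)
      (by have := hc n; fun_prop) (by fun_prop) fun s hs => by
        simp only [h]
        rcases le_total s (δ n) with hsn | hsn
        · rw [max_eq_right hsn, abs_le]
          have := hδ n
          have h2 : (δ n)⁻¹ * (s * s) ≤ s := by
            rw [inv_mul_le_iff₀ this]; nlinarith
          have h3 : 0 ≤ (δ n)⁻¹ * (s * s) := by positivity
          constructor <;> linarith
        · have : 0 < s := (hδ n).trans_le hsn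
          rw [max_eq_left hsn, ← mul_assoc, inv_mul_cancel₀ this.ne', one_mul, sub_self, abs_zero]
          exact (hδ n).le
    rwa [cfc_id' ℝ W] at h1

/-- Formally V = Z|Z|^{-1/2} and W = |Z|^{1/2}. Unlike Z|Z|^{-1}, this V is a norm limit of Z
f_n(|Z|), since s f_n(s) → √s uniformly on [0, ∞). -/
theorem exists_polar_factorization (hM : IsClosed (M : Set B)) {Z : B} (hZ : Z ∈ M) :
    ∃ V ∈ M, ∃ W ∈ M, Z = V * W ∧ star V * V = CFC.abs Z ∧ star W * W = CFC.abs Z := by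
  set W := CFC.abs Z with hW
  have hW0 : 0 ≤ W := CFC.abs_nonneg Z
  have hWM : W ∈ M := abs_mem hM hZ
  have hWW : W * W = star Z * Z := CFC.abs_mul_abs Z
  let δ : ℕ → ℝ := fun n => 1 / ((n : ℝ) + 1)
  have hδ : ∀ n, 0 < δ n := fun n => Nat.one_div_pos_of_nat
  have hδ0 : Tendsto δ atTop (𝓝 0) := tendsto_one_div_add_atTop_nhds_zero_nat
  have hsδ0 : Tendsto (fun n => √(δ n)) atTop (𝓝 0) := by
    simpa using hδ0.sqrt
  let f : ℕ → ℝ → ℝ := fun n s => (√(max s (δ n)))⁻¹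
  have hpos : ∀ n s, 0 < √(max s (δ n)) := fun n s => Real.sqrt_pos.2 (lt_max_of_lt_right (hδ n))
  have hc : ∀ n, Continuous (f n) := fun n =>
    ((continuous_id.max continuous_const).sqrt).inv₀ fun s => (hpos n s).ne'
  -- The bound √δ_n gives the uniform convergence; the bound √s gives VW = Z near s = 0.
  have hf : ∀ n s, 0 ≤ s → |s * f n s - √s| ≤ √(min s (δ n)) := fun n s hs => by
    simp only [f]
    rcases le_total s (δ n) with hsn | hsn
    · rw [max_eq_right hsn, min_eq_left hsn, abs_le]
      have h1 : 0 ≤ s * (√(δ n))⁻¹ := by positivity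
      have h2 : s * (√(δ n))⁻¹ ≤ √s := by
        rw [← div_eq_mul_inv, div_le_iff₀ (Real.sqrt_pos.2 (hδ n))]
        nth_rw 1 [← Real.mul_self_sqrt hs]
        gcongr
      constructor <;> linarith [Real.sqrt_nonneg s]
    · rw [max_eq_left hsn, ← div_eq_mul_inv, Real.div_sqrt, sub_self, abs_zero]
      positivity
  let V : ℕ → B := fun n => Z * cfc (f n) W
  have hVM : ∀ n, V n ∈ M := fun n => mul_mem hZ (cfc_real_mem hM _ hWM)
  have hlim : Tendsto (fun n => cfc (fun s => s * f n s) W) atTop (𝓝 (cfc Real.sqrt W)) := by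
    rw [tendsto_iff_norm_sub_tendsto_zero]
    refine squeeze_zero (fun _ => norm_nonneg _) (fun n => ?_) hsδ0
    refine norm_cfc_sub_le hW0 (by have := hc n; fun_prop) (by fun_prop) fun s hs => ?_
    exact (hf n s hs).trans (Real.sqrt_le_sqrt (min_le_right _ _))
  have hcauchy : CauchySeq V := by
    have h1 := hlim.cauchySeq
    rw [Metric.cauchySeq_iff] at h1 ⊢
    intro ε hε
    obtain ⟨N, hN⟩ := h1 ε hε
    refine ⟨N, fun m hm n hn => ?_⟩
    have := hN m hm n hn
    have hcm := hc m
    have hcn := hc n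
    rw [dist_eq_norm] at this ⊢
    rw [← cfc_sub _ _ W (by fun_prop) (by fun_prop)] at this
    have h2 := norm_mul_cfc_abs Z (f := fun s => f m s - f n s) (by fun_prop)
    simp only [mul_sub] at h2
    rw [← hW] at h2
    simp only [V]
    rwa [← mul_sub, ← cfc_sub (f m) (f n) W (by fun_prop) (by fun_prop), h2]
  obtain ⟨U, hU⟩ := cauchySeq_tendsto_of_complete hcauchy
  have hUM : U ∈ M := hM.mem_of_tendsto hU (Eventually.of_forall hVM)
  have hSS : cfc Real.sqrt W * cfc Real.sqrt W = W := by
    rw [← cfc_mul Real.sqrt Real.sqrt W (by fun_prop) (by fun_prop)]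
    conv_rhs => rw [← cfc_id' ℝ W]
    exact cfc_congr fun s hs => Real.mul_self_sqrt (spectrum_nonneg_of_nonneg hW0 hs)
  have hSs : star (cfc Real.sqrt W) = cfc Real.sqrt W :=
    (cfc_predicate Real.sqrt W : IsSelfAdjoint _).star_eq
  refine ⟨U, hUM, cfc Real.sqrt W, cfc_real_mem hM _ hWM, ?_, ?_, by rw [hSs, hSS]⟩
  · refine tendsto_nhds_unique (f := fun n => V n * cfc Real.sqrt W) ?_
      (hU.mul tendsto_const_nhds)
    rw [tendsto_iff_norm_sub_tendsto_zero]
    refine squeeze_zero (fun _ => norm_nonneg _) (fun n => ?_) hδ0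
    have hcn := hc n
    have h1 : V n * cfc Real.sqrt W - Z = Z * cfc (fun s => f n s * √s - 1) W := by
      simp only [V]
      rw [cfc_sub (fun s => f n s * √s) (fun _ => 1) W (by fun_prop) (by fun_prop),
        cfc_mul (f n) Real.sqrt W (by fun_prop) (by fun_prop), cfc_const_one ℝ W]
      noncomm_ring
    rw [h1, norm_mul_cfc_abs Z (by fun_prop)]
    refine norm_cfc_le (hδ n).le fun s hs => ?_
    have hs0 : 0 ≤ s := spectrum_nonneg_of_nonneg hW0 hs
    have h2 : s * (f n s * √s - 1) = √s * (s * f n s - √s) := by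
      have := Real.mul_self_sqrt hs0
      linear_combination this
    rw [h2, norm_mul, Real.norm_eq_abs, Real.norm_eq_abs, abs_of_nonneg (Real.sqrt_nonneg s)]
    rcases le_total s (δ n) with hsn | hsn
    · calc √s * |s * f n s - √s| ≤ √s * √s := by
            gcongr
            exact (hf n s hs0).trans (Real.sqrt_le_sqrt (min_le_left _ _))
        _ = s := Real.mul_self_sqrt hs0
        _ ≤ δ n := hsn
    · have : s * f n s - √s = 0 := by
        simp only [f]
        rw [max_eq_left hsn, ← div_eq_mul_inv, Real.div_sqrt, sub_self]
      rw [this, abs_zero, mul_zero]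
      exact (hδ n).le
  · have h1 : ∀ n, star (V n) * V n = cfc (fun s => s * f n s) W * cfc (fun s => s * f n s) W :=
      fun n => star_mul_cfc_abs_mul_self Z (hc n)
    refine tendsto_nhds_unique ((hU.star).mul hU) ?_
    simp only [h1]
    have := hlim.mul hlim
    rwa [hSS] at this

/-- Domination at unimodular scalars c gives −(C + D) ≤ c̄Z + cZ* ≤ C + D, so C + D + (c̄Z + cZ*) is
positive of finite trace. The values c = 1 and c = i recover Z. -/
theorem HasBound.mem_span (hT : IsConeTrace M T) {Z : B} (hZ : Z ∈ M)
    {r : ℝ≥0∞} (h : HasBound M T Z r) (hr : r < ∞) :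
    Z ∈ Submodule.span ℂ {X | X ∈ M ∧ 0 ≤ X ∧ T X < ∞} := by
  obtain ⟨C, hC, D, hD, hC0, hD0, hdom, hle⟩ := h
  have hCD : C + D ∈ M := add_mem hC hD
  have hTCD : T (C + D) < ∞ := by rw [hT.add _ hC _ hD hC0 hD0]; exact hle.trans_lt hr
  have key : ∀ c : ℂ, star c * c = 1 →
      C + D + (star c • Z + c • star Z) ∈ Submodule.span ℂ {X | X ∈ M ∧ 0 ≤ X ∧ T X < ∞} := by
    intro c hcc
    have hle' : ∀ c : ℂ, star c * c = 1 → star c • Z + c • star Z ≤ C + D := fun c hcc => by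
      have := hdom (c • 1)
      simp only [star_smul, star_one, smul_mul_assoc, one_mul, mul_smul_comm, mul_one, smul_smul,
        mul_comm c, hcc, one_smul] at this
      exact this
    have hmem : C + D + (star c • Z + c • star Z) ∈ M :=
      add_mem hCD (add_mem (SMulMemClass.smul_mem _ hZ) (SMulMemClass.smul_mem _ (star_mem hZ)))
    have h0 : 0 ≤ C + D + (star c • Z + c • star Z) := by
      have := hle' (-c) (by simpa using hcc)
      rw [star_neg, neg_smul, neg_smul, ← neg_add] at this
      rw [← sub_nonneg, sub_neg_eq_add] at this
      exact this
    refine Submodule.subset_span ⟨hmem, h0, ?_⟩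
    calc T _ ≤ T ((C + D) + (C + D)) :=
          hT.mono hmem (add_mem hCD hCD) h0 (add_le_add le_rfl (hle' c hcc))
      _ = T (C + D) + T (C + D) :=
        hT.add _ hCD _ hCD (add_nonneg hC0 hD0) (add_nonneg hC0 hD0)
      _ < ∞ := ENNReal.add_lt_top.2 ⟨hTCD, hTCD⟩
  have hCDs : C + D ∈ Submodule.span ℂ {X | X ∈ M ∧ 0 ≤ X ∧ T X < ∞} :=
    Submodule.subset_span ⟨hCD, add_nonneg hC0 hD0, hTCD⟩
  have h1 := (Submodule.add_mem_iff_right _ hCDs).1 (key 1 (by simp))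
  have h2 := (Submodule.add_mem_iff_right _ hCDs).1 (key Complex.I (by simp))
  have : Z = (1 / 2 : ℂ) • ((star (1 : ℂ) • Z + (1 : ℂ) • star Z) +
      Complex.I • (star Complex.I • Z + Complex.I • star Z)) := by
    simp only [star_one, one_smul, smul_add, smul_smul]
    simp
    module
  rw [this]
  exact Submodule.smul_mem _ _ (add_mem h1 (Submodule.smul_mem _ _ h2))

/-- Converse of `HasBound.trace_abs_le` up to a factor 2, harmless where only finiteness matters. -/
theorem hasBound_of_trace_abs (hM : IsClosed (M : Set B)) (hT : IsConeTrace M T) {Z : B}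
    (hZ : Z ∈ M) : HasBound M T Z (T (CFC.abs Z) + T (CFC.abs Z)) := by
  obtain ⟨V, hV, W, hW, h1, h2, h3⟩ := exists_polar_factorization hM hZ
  have := HasBound.mul (T := T) hV hW
  rwa [← h1, h3, ← hT.star_mul_self V hV, h2] at this

end Abstract

/-! ### Elementary tensors, coordinate projections and columns in A ⊗ 𝔹 -/

section TensorAlgebra

open Filter Topology

variable {ι : Type*} [DecidableEq ι]
variable {K : Type*} [NormedAddCommGroup K] [InnerProductSpace ℂ K]

theorem clm_ext_single {F : Type*} [NormedAddCommGroup F] [NormedSpace ℂ F]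
    {X Y : L2 ι K →L[ℂ] F} (h : ∀ y k, X (lp.single 2 y k) = Y (lp.single 2 y k)) : X = Y := by
  ext v
  have hv := lp.hasSum_single (p := 2) (by norm_num) v
  have h1 := hv.mapL X
  have h2 := hv.mapL Y
  simp only [h] at h1
  exact h1.unique h2

theorem block_ext {X Y : L2 ι K →L[ℂ] L2 ι K} (h : ∀ x y, block X x y = block Y x y) : X = Y :=
  clm_ext_single fun y k => lp.ext <| funext fun x => DFunLike.congr_fun (h x y) k

/-- The embedding `f ↦ k ⊗ f` of `ℓ²(ι)` into `K ⊗ ℓ²(ι)`. -/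
def smulVec (k : K) : L2 ι ℂ →L[ℂ] L2 ι K :=
  lp.mapCLM 2 (fun _ : ι => ContinuousLinearMap.toSpanSingleton ℂ k) (norm_nonneg k)
    (fun _ => (ContinuousLinearMap.norm_toSpanSingleton k).le)

theorem smulVec_apply (k : K) (f : L2 ι ℂ) (x : ι) : smulVec k f x = f x • k := rfl

theorem norm_smulVec_le (k : K) (f : L2 ι ℂ) : ‖smulVec k f‖ ≤ ‖k‖ * ‖f‖ :=
  (smulVec k).le_of_opNorm_le (lp.norm_mapCLM_le ..) f

theorem smulVec_single (k : K) (y : ι) (c : ℂ) :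
    smulVec k (lp.single 2 y c) = lp.single 2 y (c • k) := by
  ext x
  rw [smulVec_apply]
  by_cases h : x = y
  · subst h; simp
  · rw [lp.single_apply_ne _ _ _ h, lp.single_apply_ne _ _ _ h, zero_smul]

variable [CompleteSpace K]

theorem tensorOp_single (T : K →L[ℂ] K) (b : L2 ι ℂ →L[ℂ] L2 ι ℂ) (y : ι) (k : K) :
    tensorOp T b (lp.single 2 y k) = smulVec (T k) (b (lp.single 2 y 1)) := by
  ext x
  have := DFunLike.congr_fun (block_tensorOp T b x y) k
  exact this

/-- Knowing the action on all k ⊗ f, not only k ⊗ δ_y, gives multiplicativity of `tensorOp` without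
rearranging double series. -/
theorem tensorOp_smulVec (T : K →L[ℂ] K) (b : L2 ι ℂ →L[ℂ] L2 ι ℂ) (k : K) (f : L2 ι ℂ) :
    tensorOp T b (smulVec k f) = smulVec (T k) (b f) := by
  have : (tensorOp T b).comp (smulVec k) = (smulVec (T k)).comp b := by
    refine clm_ext_single fun y c => ?_
    have hc : lp.single 2 y c = c • (lp.single 2 y 1 : L2 ι ℂ) := by
      rw [← lp.single_smul, smul_eq_mul, mul_one]
    simp only [ContinuousLinearMap.comp_apply]
    rw [hc, map_smul, map_smul, map_smul, map_smul, smulVec_single, one_smul, tensorOp_single]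
  exact DFunLike.congr_fun this f

theorem tensorOp_mul (S T : K →L[ℂ] K) (b c : L2 ι ℂ →L[ℂ] L2 ι ℂ) :
    tensorOp S b * tensorOp T c = tensorOp (S * T) (b * c) :=
  clm_ext_single fun y k => by
    simp only [mul_apply_eq_comp, tensorOp_single, tensorOp_smulVec]

theorem block_star (X : L2 ι K →L[ℂ] L2 ι K) (x y : ι) :
    block (star X) x y = star (block X y x) := by
  ext k
  refine ext_inner_right ℂ fun l => ?_
  rw [ContinuousLinearMap.star_eq_adjoint, ContinuousLinearMap.star_eq_adjoint,
    ContinuousLinearMap.adjoint_inner_left, block_apply, block_apply, ← lp.inner_single_right,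
    ContinuousLinearMap.adjoint_inner_left, lp.inner_single_left]

theorem coef_eq_inner (b : L2 ι ℂ →L[ℂ] L2 ι ℂ) (x y : ι) :
    coef b x y = inner ℂ (lp.single 2 x (1 : ℂ)) (b (lp.single 2 y (1 : ℂ))) := by
  rw [lp.inner_single_left]; simp [coef]

theorem coef_star (b : L2 ι ℂ →L[ℂ] L2 ι ℂ) (x y : ι) :
    coef (star b) x y = star (coef b y x) := by
  rw [coef_eq_inner, coef_eq_inner, ContinuousLinearMap.star_eq_adjoint,
    ContinuousLinearMap.adjoint_inner_right]
  exact (inner_conj_symm _ _).symm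

theorem star_tensorOp (T : K →L[ℂ] K) (b : L2 ι ℂ →L[ℂ] L2 ι ℂ) :
    star (tensorOp T b) = tensorOp (star T) (star b) :=
  block_ext fun x y => by
    rw [block_star, block_tensorOp, block_tensorOp, star_smul, coef_star]

theorem coef_one (x y : ι) : coef (1 : L2 ι ℂ →L[ℂ] L2 ι ℂ) x y = if x = y then 1 else 0 := by
  simp only [coef, one_apply_eq_self]
  split_ifs with h
  · subst h; simp
  · exact lp.single_apply_ne _ _ _ h

theorem tensorOp_one : tensorOp (1 : K →L[ℂ] K) (1 : L2 ι ℂ →L[ℂ] L2 ι ℂ) = 1 :=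
  clm_ext_single fun y k => by
    rw [tensorOp_single]
    simp [smulVec_single]

variable {A : Type*} [CStarAlgebra A]

/-- The algebraic tensor product `A ⊙ 𝔹` as a star subalgebra. -/
def algTensor (ι : Type*) [DecidableEq ι] (π : A →⋆ₐ[ℂ] (K →L[ℂ] K)) :
    StarSubalgebra ℂ (L2 ι K →L[ℂ] L2 ι K) where
  toSubalgebra := (Submodule.span ℂ {X | ∃ (a : A) (b : L2 ι ℂ →L[ℂ] L2 ι ℂ),
      X = tensorOp (π a) b}).toSubalgebra
    (Submodule.subset_span ⟨1, 1, by rw [map_one, tensorOp_one]⟩)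
    (fun X Y hX hY => by
      have h := Submodule.mul_mem_mul hX hY
      rw [Submodule.span_mul_span] at h
      refine Submodule.span_mono ?_ h
      rintro _ ⟨_, ⟨a, b, rfl⟩, _, ⟨a', b', rfl⟩, rfl⟩
      exact ⟨a * a', b * b', by simp only [tensorOp_mul, map_mul]⟩)
  star_mem' := fun {X} hX => by
    change X ∈ Submodule.span ℂ _ at hX
    change star X ∈ Submodule.span ℂ _
    induction hX using Submodule.span_induction with
    | mem X h =>
      obtain ⟨a, b, rfl⟩ := h
      exact Submodule.subset_span ⟨star a, star b, by rw [star_tensorOp, map_star]⟩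
    | zero => rw [star_zero]; exact zero_mem _
    | add X Y _ _ hX hY => rw [star_add]; exact add_mem hX hY
    | smul c X _ hX => rw [star_smul]; exact Submodule.smul_mem _ _ hX

/-- The spatial tensor product `A ⊗ 𝔹` as a star subalgebra. -/
def tensorAlgebra (ι : Type*) [DecidableEq ι] (π : A →⋆ₐ[ℂ] (K →L[ℂ] K)) :
    StarSubalgebra ℂ (L2 ι K →L[ℂ] L2 ι K) :=
  (algTensor ι π).topologicalClosure

theorem isClosed_tensorAlgebra (π : A →⋆ₐ[ℂ] (K →L[ℂ] K)) :
    IsClosed (tensorAlgebra ι π : Set (L2 ι K →L[ℂ] L2 ι K)) :=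
  (algTensor ι π).isClosed_topologicalClosure

theorem tensorOp_mem (π : A →⋆ₐ[ℂ] (K →L[ℂ] K)) (a : A) (b : L2 ι ℂ →L[ℂ] L2 ι ℂ) :
    tensorOp (π a) b ∈ tensorAlgebra ι π :=
  Submodule.le_topologicalClosure _ (Submodule.subset_span ⟨a, b, rfl⟩)

/-- The projection of `K ⊗ ℓ²(ι)` onto the coordinates in a finite set. -/
def proj (K : Type*) [NormedAddCommGroup K] [InnerProductSpace ℂ K] (F : Finset ι) :
    L2 ι K →L[ℂ] L2 ι K :=
  ∑ y ∈ F, (lp.singleContinuousLinearMap ℂ (fun _ : ι => K) 2 y).comp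
    (lp.evalCLM ℂ (fun _ : ι => K) 2 y)

theorem proj_eq_sum (F : Finset ι) (v : L2 ι K) :
    proj K F v = ∑ y ∈ F, lp.single 2 y (v y) := by
  simp only [proj, sum_apply]
  rfl

theorem proj_apply (F : Finset ι) (v : L2 ι K) (x : ι) :
    proj K F v x = if x ∈ F then v x else 0 := by
  rw [proj_eq_sum, lp.coeFn_sum, Finset.sum_apply]
  simp only [lp.coeFn_single, Finset.sum_pi_single]

theorem proj_single (F : Finset ι) (y : ι) (k : K) :
    proj K F (lp.single 2 y k) = if y ∈ F then lp.single 2 y k else 0 := by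
  ext x
  rw [proj_apply]
  by_cases h : x = y
  · subst h; split_ifs <;> simp
  · rw [lp.single_apply_ne _ _ _ h]
    split_ifs
    · rw [lp.single_apply_ne _ _ _ h]
    · simp
    · rw [lp.single_apply_ne _ _ _ h]
    · simp

theorem norm_proj_le (F : Finset ι) : ‖proj K F‖ ≤ 1 := by
  refine ContinuousLinearMap.opNorm_le_bound _ zero_le_one fun v => ?_
  have h1 := lp.norm_sum_single (p := 2) (by norm_num) (fun y => v y) F
  have h2 := lp.sum_rpow_le_norm_rpow (p := 2) (by norm_num) v F
  rw [← h1, ← proj_eq_sum] at h2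
  rw [one_mul]
  simp only [ENNReal.toReal_ofNat, Real.rpow_ofNat] at h2
  exact le_of_sq_le_sq h2 (norm_nonneg _)

theorem tendsto_proj (v : L2 ι K) : Tendsto (fun F => proj K F v) atTop (𝓝 v) := by
  simp only [proj_eq_sum]
  exact lp.hasSum_single (p := 2) (by norm_num) v

theorem block_mul_proj (X : L2 ι K →L[ℂ] L2 ι K) (F : Finset ι) (x y : ι) :
    block (X * proj K F) x y = if y ∈ F then block X x y else 0 := by
  ext k
  rw [block_apply, mul_apply_eq_comp, proj_single]
  split_ifs
  · rfl
  · simp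

theorem block_proj_mul (X : L2 ι K →L[ℂ] L2 ι K) (F : Finset ι) (x y : ι) :
    block (proj K F * X) x y = if x ∈ F then block X x y else 0 := by
  ext k
  rw [block_apply, mul_apply_eq_comp, proj_apply]
  split_ifs
  · rfl
  · simp

theorem block_one (x y : ι) : block (1 : L2 ι K →L[ℂ] L2 ι K) x y = if x = y then 1 else 0 := by
  rw [← tensorOp_one, block_tensorOp, coef_one]
  split_ifs <;> simp

theorem star_proj (F : Finset ι) : star (proj K F) = proj K F :=
  block_ext fun x y => by
    rw [block_star, ← one_mul (proj K F), block_mul_proj, block_mul_proj, block_one, block_one]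
    by_cases h : x = y
    · subst h; split_ifs <;> simp
    · rw [if_neg h, if_neg (Ne.symm h)]; simp

theorem coef_proj (F : Finset ι) (x y : ι) :
    coef (proj ℂ F) x y = if y ∈ F then if x = y then 1 else 0 else 0 := by
  rw [coef, proj_single, ← coef_one x y]
  split_ifs
  · rfl
  · simp

theorem proj_eq_tensorOp (F : Finset ι) : proj K F = tensorOp 1 (proj ℂ F) :=
  block_ext fun x y => by
    rw [block_tensorOp, coef_proj, ← one_mul (proj K F), block_mul_proj, block_one]
    split_ifs <;> simp

theorem proj_mem (π : A →⋆ₐ[ℂ] (K →L[ℂ] K)) (F : Finset ι) : proj K F ∈ tensorAlgebra ι π := by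
  rw [proj_eq_tensorOp, ← map_one π]
  exact tensorOp_mem π 1 _

/-- Every column of an element of `A ⊗ 𝔹` is a norm limit of its finite parts. -/
theorem tendsto_proj_column (π : A →⋆ₐ[ℂ] (K →L[ℂ] K)) {X : L2 ι K →L[ℂ] L2 ι K}
    (hX : X ∈ tensorAlgebra ι π) (x : ι) :
    Tendsto (fun F => (proj K F).comp
      (X.comp (lp.singleContinuousLinearMap ℂ (fun _ : ι => K) 2 x))) atTop
      (𝓝 (X.comp (lp.singleContinuousLinearMap ℂ (fun _ : ι => K) 2 x))) := by
  set S := lp.singleContinuousLinearMap ℂ (fun _ : ι => K) 2 x with hS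
  have hS1 : ‖S‖ ≤ 1 := ContinuousLinearMap.opNorm_le_bound _ zero_le_one fun k => by
    rw [one_mul]
    exact (lp.norm_single (E := fun _ : ι => K) (p := 2) (by norm_num) x k).le
  have halg : ∀ Y ∈ algTensor ι π, Tendsto (fun F => (proj K F).comp (Y.comp S)) atTop
      (𝓝 (Y.comp S)) := by
    -- For Y = a ⊗ b the column is k ↦ ak ⊗ bδ_x, and the finite parts of the single vector bδ_x
    -- converge in ℓ², uniformly over ‖k‖ ≤ 1. The general X follows by an ε/3 argument.
    intro Y hY
    change Y ∈ Submodule.span ℂ _ at hY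
    induction hY using Submodule.span_induction with
    | mem Y h =>
      obtain ⟨a, b, rfl⟩ := h
      refine (tendsto_iff_norm_sub_tendsto_zero (E := K →L[ℂ] L2 ι K)).2 ?_
      have h0 := (tendsto_iff_norm_sub_tendsto_zero.1
        (tendsto_proj (b (lp.single 2 x 1)))).mul_const ‖π a‖
      rw [zero_mul] at h0
      refine squeeze_zero (fun _ => ContinuousLinearMap.opNorm_nonneg _) (fun F => ?_) h0
      refine ContinuousLinearMap.opNorm_le_bound _ (by positivity) fun k => ?_
      have h1 : ((proj K F).comp ((tensorOp (π a) b).comp S) - (tensorOp (π a) b).comp S) k =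
          smulVec (π a k) (proj ℂ F (b (lp.single 2 x 1)) - b (lp.single 2 x 1)) := by
        change proj K F (tensorOp (π a) b (lp.single 2 x k)) - tensorOp (π a) b (lp.single 2 x k) = _
        rw [tensorOp_single, proj_eq_tensorOp, tensorOp_smulVec, map_sub]
        rfl
      rw [h1]
      refine (norm_smulVec_le _ _).trans ?_
      rw [mul_comm, mul_assoc]
      gcongr
      exact (π a).le_opNorm k
    | zero => simp
    | add Y Z _ _ hY hZ =>
      simp only [ContinuousLinearMap.add_comp, ContinuousLinearMap.comp_add]
      exact hY.add hZ
    | smul c Y _ hY =>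
      simp only [ContinuousLinearMap.smul_comp, ContinuousLinearMap.comp_smul]
      exact hY.const_smul c
  refine (Metric.tendsto_atTop (α := K →L[ℂ] L2 ι K)).2 ?_
  intro ε hε
  obtain ⟨Y, hY, hXY⟩ := Metric.mem_closure_iff.1 hX (ε / 3) (by positivity)
  obtain ⟨N, hN⟩ := (Metric.tendsto_atTop (α := K →L[ℂ] L2 ι K)).1 (halg Y hY) (ε / 3) (by positivity)
  refine ⟨N, fun F hF => ?_⟩
  have h1 := (dist_eq_norm (E := K →L[ℂ] L2 ι K) _ _).symm.trans_lt (hN F hF)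
  rw [dist_eq_norm] at hXY
  refine (dist_eq_norm (E := K →L[ℂ] L2 ι K) _ _).trans_lt ?_
  have h2 : ‖(X - Y).comp S‖ ≤ ‖X - Y‖ :=
    (ContinuousLinearMap.opNorm_comp_le _ _).trans
      (mul_le_of_le_one_right (norm_nonneg _) hS1)
  have h3 : ‖(proj K F).comp ((X - Y).comp S)‖ ≤ ‖X - Y‖ :=
    (ContinuousLinearMap.opNorm_comp_le _ _).trans
      ((mul_le_of_le_one_left (norm_nonneg _) (norm_proj_le F)).trans h2)
  have h4 : (proj K F).comp (X.comp S) - X.comp S =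
      (proj K F).comp ((X - Y).comp S) + ((proj K F).comp (Y.comp S) - Y.comp S)
        - (X - Y).comp S := by
    simp only [ContinuousLinearMap.sub_comp, ContinuousLinearMap.comp_sub]
    abel
  rw [h4]
  calc _ ≤ ‖(proj K F).comp ((X - Y).comp S)‖ + ‖(proj K F).comp (Y.comp S) - Y.comp S‖
        + ‖(X - Y).comp S‖ := 
        (norm_sub_le (E := K →L[ℂ] L2 ι K) _ _).trans
          (by gcongr; exact ContinuousLinearMap.opNorm_add_le _ _)
    _ < ε := by linarith

/-- The convergence is in operator norm, as continuity of τ requires; for an arbitrary bounded X it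
would only be strong. -/
theorem hasSum_block_star_mul (π : A →⋆ₐ[ℂ] (K →L[ℂ] K)) {X : L2 ι K →L[ℂ] L2 ι K}
    (hX : X ∈ tensorAlgebra ι π) (x : ι) :
    HasSum (fun y => star (block X y x) * block X y x) (block (star X * X) x x) := by
  have h := tendsto_proj_column π hX x
  have h2 := ((lp.evalCLM ℂ (fun _ : ι => K) 2 x).comp (star X)).postcomp K |>.continuous.tendsto _
    |>.comp h
  refine h2.congr fun F => ?_
  ext k
  simp only [sum_apply, mul_apply_eq_comp, ← block_star]
  change (star X) (proj K F (X (lp.single 2 x k))) x = ∑ y ∈ F, star X (lp.single 2 y _) x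
  rw [proj_eq_sum, map_sum, lp.coeFn_sum, Finset.sum_apply]
  rfl

end TensorAlgebra

/-! ### τ ⊗ Tr is a lower semicontinuous trace on the positive cone -/

section Trace

open Filter Topology

variable {ι : Type*} [DecidableEq ι]
variable {K : Type*} [NormedAddCommGroup K] [InnerProductSpace ℂ K] [CompleteSpace K]
variable {A : Type*} [CStarAlgebra A] {π : A →⋆ₐ[ℂ] (K →L[ℂ] K)} {τ : A →L[ℂ] ℂ}

theorem continuous_block (x y : ι) :
    Continuous fun X : L2 ι K →L[ℂ] L2 ι K => block X x y :=
  continuous_const.clm_comp (continuous_id.clm_comp continuous_const)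

theorem entry_eq_of_map_eq (hπ : Function.Injective π) {X : L2 ι K →L[ℂ] L2 ι K} {x y : ι} {a : A}
    (h : π a = block X x y) : entry π X x y = a := by
  rw [entry, ← h, Function.leftInverse_invFun hπ a]

theorem entry_tensorOp (hπ : Function.Injective π) (a : A) (b : L2 ι ℂ →L[ℂ] L2 ι ℂ) (x y : ι) :
    entry π (tensorOp (π a) b) x y = coef b x y • a :=
  entry_eq_of_map_eq hπ (by rw [block_tensorOp, map_smul])

theorem entry_add (hπ : Function.Injective π) {X Y : L2 ι K →L[ℂ] L2 ι K}
    (hX : X ∈ tensorAlgebra ι π) (hY : Y ∈ tensorAlgebra ι π) (x y : ι) :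
    entry π (X + Y) x y = entry π X x y + entry π Y x y :=
  entry_eq_of_map_eq hπ (by rw [map_add, map_entry π hπ hX, map_entry π hπ hY]; rfl)

theorem entry_smul (hπ : Function.Injective π) {X : L2 ι K →L[ℂ] L2 ι K}
    (hX : X ∈ tensorAlgebra ι π) (c : ℂ) (x y : ι) :
    entry π (c • X) x y = c • entry π X x y :=
  entry_eq_of_map_eq hπ (by rw [map_smul, map_entry π hπ hX]; rfl)

theorem entry_star (hπ : Function.Injective π) {X : L2 ι K →L[ℂ] L2 ι K}
    (hX : X ∈ tensorAlgebra ι π) (x y : ι) :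
    entry π (star X) x y = star (entry π X y x) :=
  entry_eq_of_map_eq hπ (by rw [map_star, map_entry π hπ hX, block_star])

theorem tendsto_entry (hπ : Function.Injective π) {X : ℕ → L2 ι K →L[ℂ] L2 ι K}
    {Y : L2 ι K →L[ℂ] L2 ι K} (hX : ∀ n, X n ∈ tensorAlgebra ι π) (hY : Y ∈ tensorAlgebra ι π)
    (h : Tendsto X atTop (𝓝 Y)) (x y : ι) :
    Tendsto (fun n => entry π (X n) x y) atTop (𝓝 (entry π Y x y)) := by
  rw [(NonUnitalStarAlgHom.isometry π hπ).isEmbedding.tendsto_nhds_iff, map_entry π hπ hY]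
  refine (((continuous_block x y).tendsto Y).comp h).congr fun n => ?_
  exact (map_entry π hπ (hX n) x y).symm

theorem hasSum_entry_star_mul (hπ : Function.Injective π) {X : L2 ι K →L[ℂ] L2 ι K}
    (hX : X ∈ tensorAlgebra ι π) (x : ι) :
    HasSum (fun y => star (entry π X y x) * entry π X y x) (entry π (star X * X) x x) := by
  refine ((NonUnitalStarAlgHom.isometry π hπ).isEmbedding.isInducing.hasSum_iff (g := π) _ _).1 ?_
  have hXX : star X * X ∈ tensorAlgebra ι π := mul_mem (star_mem hX) hX
  rw [map_entry π hπ hXX]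
  refine (hasSum_block_star_mul π hX x).congr_fun fun y => ?_
  simp only [Function.comp_apply, map_mul, map_star, map_entry π hπ hX]

theorem IsFaithfulTrace.re_nonneg (hτ : IsFaithfulTrace τ) (a : A) : 0 ≤ (τ (star a * a)).re :=
  (Complex.nonneg_iff.1 (hτ.nonneg a)).1

theorem hasSum_trace_star_mul (hπ : Function.Injective π) (τ : A →L[ℂ] ℂ)
    {X : L2 ι K →L[ℂ] L2 ι K} (hX : X ∈ tensorAlgebra ι π) (x : ι) :
    HasSum (fun y => (τ (star (entry π X y x) * entry π X y x)).re)
      (τ (entry π (star X * X) x x)).re :=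
  Complex.hasSum_re ((hasSum_entry_star_mul hπ hX x).mapL τ)

theorem hatTrace_star_mul_self (hτ : IsFaithfulTrace τ) (hπ : Function.Injective π)
    {X : L2 ι K →L[ℂ] L2 ι K} (hX : X ∈ tensorAlgebra ι π) :
    hatTrace τ π (star X * X) =
      ∑' x, ∑' y, ENNReal.ofReal (τ (star (entry π X y x) * entry π X y x)).re := by
  refine tsum_congr fun x => ?_
  have h := hasSum_trace_star_mul hπ τ hX x
  rw [← h.tsum_eq, ENNReal.ofReal_tsum_of_nonneg (fun y => hτ.re_nonneg _) h.summable]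

/-- Guarantees that `ENNReal.ofReal` in `hatTrace` truncates nothing on the cone, which additivity
needs. -/
theorem trace_entry_nonneg (hτ : IsFaithfulTrace τ) (hπ : Function.Injective π)
    {X : L2 ι K →L[ℂ] L2 ι K} (hX : X ∈ tensorAlgebra ι π) (h0 : 0 ≤ X) (x : ι) :
    0 ≤ (τ (entry π X x x)).re := by
  obtain ⟨R, hR, hRs, hRR⟩ := exists_star_mul_self_eq (isClosed_tensorAlgebra π) hX h0
  have h := hasSum_trace_star_mul hπ τ hR x
  rw [hRs, hRR] at h
  exact h.nonneg fun y => hτ.re_nonneg _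

theorem isConeTrace_hatTrace (hτ : IsFaithfulTrace τ) (hπ : Function.Injective π) :
    IsConeTrace (tensorAlgebra ι π) (hatTrace τ π) where
  add X hX Y hY hX0 hY0 := by
    simp only [hatTrace]
    rw [← ENNReal.tsum_add]
    refine tsum_congr fun x => ?_
    rw [entry_add hπ hX hY, map_add, Complex.add_re, ENNReal.ofReal_add
      (trace_entry_nonneg hτ hπ hX hX0 x) (trace_entry_nonneg hτ hπ hY hY0 x)]
  smul X hX hX0 c hc := by
    simp only [hatTrace]
    rw [← ENNReal.tsum_mul_left]
    refine tsum_congr fun x => ?_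
    rw [entry_smul hπ hX, map_smul, smul_eq_mul, Complex.re_ofReal_mul, ENNReal.ofReal_mul hc]
  lsc X Y r hX hY hr h := by
    simp only [hatTrace]
    -- A supremum of finite partial sums, each norm continuous, is lower semicontinuous.
    rw [ENNReal.tsum_eq_iSup_sum]
    refine iSup_le fun F => ?_
    refine le_of_tendsto (tendsto_finsetSum F fun x _ => ENNReal.tendsto_ofReal
      (((Complex.continuous_re.comp τ.continuous).tendsto _).comp
        (tendsto_entry hπ hX hY h x x))) (Eventually.of_forall fun n => ?_)
    exact (ENNReal.sum_le_tsum F).trans (hr n)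
  star_mul_self X hX := by
    -- X*X and XX* give the same double series of nonnegative terms, up to swapping x with y and
    -- applying traciality of τ entrywise.
    have h := hatTrace_star_mul_self hτ hπ (star_mem hX)
    rw [star_star] at h
    rw [h, hatTrace_star_mul_self hτ hπ hX, ENNReal.tsum_comm]
    refine tsum_congr fun x => tsum_congr fun y => ?_
    rw [entry_star hπ hX, star_star, hτ.mul_comm]

theorem hatTrace_tensorOp (hπ : Function.Injective π) {a : A} {b : L2 ι ℂ →L[ℂ] L2 ι ℂ}
    (ha : 0 ≤ τ a) :
    hatTrace τ π (tensorOp (π a) b) =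
      (∑' x, ENNReal.ofReal (coef b x x).re) * ENNReal.ofReal (τ a).re := by
  rw [hatTrace, ← ENNReal.tsum_mul_right]
  refine tsum_congr fun x => ?_
  obtain ⟨h1, h2⟩ := Complex.nonneg_iff.1 ha
  rw [entry_tensorOp hπ, map_smul, smul_eq_mul, Complex.mul_re, ← h2, mul_zero, sub_zero,
    ENNReal.ofReal_mul' h1]

theorem hatTrace_proj_mul_proj (hπ : Function.Injective π) {X : L2 ι K →L[ℂ] L2 ι K}
    (hX : X ∈ tensorAlgebra ι π) (F : Finset ι) :
    hatTrace τ π ((1 - proj K F) * X * (1 - proj K F)) =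
      ∑' x : {x // x ∉ F}, ENNReal.ofReal (τ (entry π X x x)).re := by
  refine Eq.trans ?_
    (tsum_subtype {x | x ∉ F} fun x => ENNReal.ofReal (τ (entry π X x x)).re).symm
  refine tsum_congr fun x => ?_
  have hb : block ((1 - proj K F) * X * (1 - proj K F)) x x = if x ∈ F then 0 else block X x x := by
    have h1 : (1 - proj K F) * X * (1 - proj K F) =
        X - proj K F * X - X * proj K F + proj K F * (X * proj K F) := by noncomm_ring
    have h2 : block (X - proj K F * X - X * proj K F + proj K F * (X * proj K F)) x x =
      block X x x - block (proj K F * X) x x - block (X * proj K F) x x +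
        block (proj K F * (X * proj K F)) x x := by ext; rfl
    rw [h1, h2, block_proj_mul, block_proj_mul, block_mul_proj]
    split_ifs <;> simp
  by_cases h : x ∈ F
  · have : entry π ((1 - proj K F) * X * (1 - proj K F)) x x = 0 :=
      entry_eq_of_map_eq hπ (by rw [hb, if_pos h, map_zero])
    simp [this, h]
  · have : entry π ((1 - proj K F) * X * (1 - proj K F)) x x = entry π X x x :=
      entry_eq_of_map_eq hπ (by rw [hb, if_neg h, map_entry π hπ hX])
    simp [this, h]

end Trace

/-! ### Trace-norm approximation and the two inclusions -/

section TraceClass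

open Filter Topology

variable {ι : Type*} [DecidableEq ι]

/-- A weighted Cauchy–Schwarz bound: write VW as (s^{-1/2}V)(s^{1/2}W). The free weight makes VW
small when only one factor is. -/
theorem hasBound_mul_of_pos {B : Type*} [CStarAlgebra B] [PartialOrder B] [StarOrderedRing B]
    {M : StarSubalgebra ℂ B} {T : B → ℝ≥0∞} (hT : IsConeTrace M T) {V W : B} (hV : V ∈ M)
    (hW : W ∈ M) {s : ℝ} (hs : 0 < s) :
    HasBound M T (V * W)
      (ENNReal.ofReal s * T (star W * W) + ENNReal.ofReal s⁻¹ * T (V * star V)) := by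
  have hd : √s ≠ 0 := (Real.sqrt_pos.2 hs).ne'
  have hss : √s * √s = s := Real.mul_self_sqrt hs.le
  have h := HasBound.mul (T := T) (V := (((√s)⁻¹ : ℝ) : ℂ) • V) (W := ((√s : ℝ) : ℂ) • W)
    (SMulMemClass.smul_mem _ hV) (SMulMemClass.smul_mem _ hW)
  have h1 : ((((√s)⁻¹ : ℝ) : ℂ) • V) * (((√s : ℝ) : ℂ) • W) = V * W := by
    rw [smul_mul_smul_comm, ← Complex.ofReal_mul, inv_mul_cancel₀ hd, Complex.ofReal_one, one_smul]
  have h2 : star (((√s : ℝ) : ℂ) • W) * (((√s : ℝ) : ℂ) • W) = (s : ℂ) • (star W * W) := by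
    rw [star_smul, smul_mul_smul_comm, Complex.star_def, Complex.conj_ofReal, ← Complex.ofReal_mul,
      hss]
  have h3 : ((((√s)⁻¹ : ℝ) : ℂ) • V) * star ((((√s)⁻¹ : ℝ) : ℂ) • V) =
      ((s⁻¹ : ℝ) : ℂ) • (V * star V) := by
    rw [star_smul, smul_mul_smul_comm, Complex.star_def, Complex.conj_ofReal, ← Complex.ofReal_mul,
      ← mul_inv, hss]
  rwa [h1, h2, h3, hT.smul _ (mul_mem (star_mem hW) hW) (star_mul_self_nonneg W) s hs.le,
    hT.smul _ (mul_mem hV (star_mem hV)) (mul_star_self_nonneg V) s⁻¹ (inv_pos.2 hs).le] at h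

theorem tsum_coef_star_mul_self (V : L2 ι ℂ →L[ℂ] L2 ι ℂ) :
    ∑' x, ENNReal.ofReal (coef (star V * V) x x).re =
      ∑' x, ∑' y, ENNReal.ofReal (‖coef V y x‖ ^ 2) := by
  refine tsum_congr fun x => ?_
  have h1 : (coef (star V * V) x x).re = ‖V (lp.single 2 x (1 : ℂ))‖ ^ 2 := by
    rw [coef_eq_inner, mul_apply_eq_comp, ContinuousLinearMap.star_eq_adjoint,
      ContinuousLinearMap.adjoint_inner_right]
    exact inner_self_eq_norm_sq (𝕜 := ℂ) _
  have h2 := lp.hasSum_norm (p := 2) (by norm_num) (V (lp.single 2 x (1 : ℂ)))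
  simp only [ENNReal.toReal_ofNat, Real.rpow_ofNat] at h2
  rw [h1, ← h2.tsum_eq, ENNReal.ofReal_tsum_of_nonneg (fun y => sq_nonneg _) h2.summable]
  rfl

theorem tsum_coef_mul_star_self (V : L2 ι ℂ →L[ℂ] L2 ι ℂ) :
    ∑' x, ENNReal.ofReal (coef (V * star V) x x).re =
      ∑' x, ENNReal.ofReal (coef (star V * V) x x).re := by
  have h := tsum_coef_star_mul_self (star V)
  rw [star_star] at h
  rw [h, tsum_coef_star_mul_self, ENNReal.tsum_comm]
  refine tsum_congr fun x => tsum_congr fun y => ?_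
  rw [coef_star, norm_star]

section MatrixUnits

variable {K : Type*} [NormedAddCommGroup K] [InnerProductSpace ℂ K]

/-- The matrix unit `1 ⊗ E_{xy}` on `K ⊗ ℓ²(ι)`. -/
def matrixUnit (K : Type*) [NormedAddCommGroup K] [InnerProductSpace ℂ K] (x y : ι) :
    L2 ι K →L[ℂ] L2 ι K :=
  (lp.singleContinuousLinearMap ℂ (fun _ : ι => K) 2 x).comp (lp.evalCLM ℂ (fun _ : ι => K) 2 y)

theorem matrixUnit_apply (x y : ι) (v : L2 ι K) :
    matrixUnit K x y v = lp.single 2 x (v y) := rfl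

theorem matrixUnit_mul_matrixUnit (x y z : ι) :
    matrixUnit K x y * matrixUnit K y z = matrixUnit K x z := by
  ext1 v
  rw [mul_apply_eq_comp, matrixUnit_apply, matrixUnit_apply, matrixUnit_apply,
    lp.single_apply_self]

theorem star_matrixUnit [CompleteSpace K] (x y : ι) :
    star (matrixUnit K x y) = matrixUnit K y x := by
  ext1 v
  refine ext_inner_right ℂ fun w => ?_
  rw [ContinuousLinearMap.star_eq_adjoint, ContinuousLinearMap.adjoint_inner_left,
    matrixUnit_apply, matrixUnit_apply, lp.inner_single_right, lp.inner_single_left]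

theorem coef_matrixUnit (x y z w : ι) :
    coef (matrixUnit ℂ x y) z w = if x = z then if y = w then 1 else 0 else 0 := by
  rw [coef, matrixUnit_apply]
  by_cases h : x = z
  · subst h
    rw [lp.single_apply_self, if_pos rfl]
    split_ifs with h
    · subst h; exact lp.single_apply_self ..
    · exact lp.single_apply_ne _ _ _ h
  · rw [if_neg h, lp.single_apply_ne _ _ _ (Ne.symm h)]

theorem isTraceClass_matrixUnit (x y : ι) : IsTraceClass (matrixUnit ℂ x y) := by
  have h0 : 0 ≤ matrixUnit ℂ y y := by
    rw [← matrixUnit_mul_matrixUnit y y y]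
    nth_rw 1 [← star_matrixUnit]
    exact star_mul_self_nonneg _
  have habs : absOp (matrixUnit ℂ x y) = matrixUnit ℂ y y :=
    abs_eq_of_mul_self_eq
      (by rw [star_matrixUnit, matrixUnit_mul_matrixUnit, matrixUnit_mul_matrixUnit]) h0
  rw [IsTraceClass, habs]
  refine summable_of_ne_finset_zero (s := {y}) fun z hz => ?_
  rw [coef_matrixUnit, if_neg fun h => hz (by simp [h])]
  rfl

end MatrixUnits

variable {K : Type*} [NormedAddCommGroup K] [InnerProductSpace ℂ K] [CompleteSpace K]
variable {A : Type*} [CStarAlgebra A] {π : A →⋆ₐ[ℂ] (K →L[ℂ] K)} {τ : A →L[ℂ] ℂ}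

/-- Factor b = VW with V*V = W*W = |b|, and a ⊗ b = (a ⊗ V)(1 ⊗ W). The two traces are τ(1) Tr|b|
and τ(aa*) Tr|b|. -/
theorem hasBound_tensorOp (hτ : IsFaithfulTrace τ) (hπ : Function.Injective π) (a : A)
    {b : L2 ι ℂ →L[ℂ] L2 ι ℂ} (hb : IsTraceClass b) :
    ∃ r < ∞, HasBound (tensorAlgebra ι π) (hatTrace τ π) (tensorOp (π a) b) r := by
  obtain ⟨V, -, W, -, h1, h2, h3⟩ :=
    exists_polar_factorization (M := (⊤ : StarSubalgebra ℂ (L2 ι ℂ →L[ℂ] L2 ι ℂ))) isClosed_univ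
      (Z := b) trivial
  have hfin : ∑' x, ENNReal.ofReal (coef (absOp b) x x).re < ∞ := hb.tsum_ofReal_lt_top
  have h := HasBound.mul (T := hatTrace τ π) (tensorOp_mem π a V) (tensorOp_mem π 1 W)
  rw [tensorOp_mul, ← map_mul, mul_one, ← h1] at h
  refine ⟨_, ?_, h⟩
  have ha : 0 ≤ τ (a * star a) := by simpa using hτ.nonneg (star a)
  have h1' : 0 ≤ τ (star 1 * 1) := hτ.nonneg 1
  rw [star_tensorOp, star_tensorOp, tensorOp_mul, tensorOp_mul, ← map_star, ← map_star, ← map_mul,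
    ← map_mul, hatTrace_tensorOp hπ ha, hatTrace_tensorOp hπ h1', tsum_coef_mul_star_self, h2, h3]
  exact ENNReal.add_lt_top.2 ⟨ENNReal.mul_lt_top hfin ENNReal.ofReal_lt_top,
    ENNReal.mul_lt_top hfin ENNReal.ofReal_lt_top⟩

theorem algTensorTraceClass_le (ι : Type*) [DecidableEq ι] (π : A →⋆ₐ[ℂ] (K →L[ℂ] K)) :
    algTensorTraceClass ι π ≤ spatialTensor ι π := by
  refine (Submodule.span_mono ?_).trans (Submodule.le_topologicalClosure _)
  rintro _ ⟨a, b, -, rfl⟩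
  exact ⟨a, b, rfl⟩

theorem hatTrace_zero (hτ : IsFaithfulTrace τ) (hπ : Function.Injective π) :
    hatTrace τ π (0 : L2 ι K →L[ℂ] L2 ι K) = 0 := by
  have := (isConeTrace_hatTrace (ι := ι) hτ hπ).smul 0 (zero_mem _) le_rfl 0 le_rfl
  simpa using this

theorem hasBound_zero (hτ : IsFaithfulTrace τ) (hπ : Function.Injective π) (r : ℝ≥0∞) :
    HasBound (tensorAlgebra ι π) (hatTrace τ π) 0 r := by
  have := HasBound.mul (T := hatTrace τ π) (zero_mem (tensorAlgebra ι π))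
    (zero_mem (tensorAlgebra ι π))
  rw [mul_zero, mul_zero, zero_mul, hatTrace_zero hτ hπ] at this
  exact this.mono (by simp)

theorem exists_hasBound_of_mem_algTensorTraceClass (hτ : IsFaithfulTrace τ)
    (hπ : Function.Injective π) {Y : L2 ι K →L[ℂ] L2 ι K} (hY : Y ∈ algTensorTraceClass ι π) :
    ∃ r < ∞, HasBound (tensorAlgebra ι π) (hatTrace τ π) Y r := by
  have hT := isConeTrace_hatTrace (ι := ι) hτ hπ
  induction hY using Submodule.span_induction with
  | mem Y h =>
    obtain ⟨a, b, hb, rfl⟩ := h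
    exact hasBound_tensorOp hτ hπ a hb
  | zero => exact ⟨0, ENNReal.zero_lt_top, hasBound_zero hτ hπ 0⟩
  | add Y Z _ _ hY hZ =>
    obtain ⟨r, hr, h⟩ := hY
    obtain ⟨s, hs, h'⟩ := hZ
    exact ⟨_, ENNReal.add_lt_top.2 ⟨hr, hs⟩, h.add hT h'⟩
  | smul c Y _ hY =>
    obtain ⟨r, hr, h⟩ := hY
    exact ⟨_, ENNReal.mul_lt_top
      (ENNReal.add_lt_top.2 ⟨ENNReal.one_lt_top, ENNReal.ofReal_lt_top⟩) hr, h.smul hT c⟩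

theorem traceClassElements_eq_span (τ : A →L[ℂ] ℂ) (π : A →⋆ₐ[ℂ] (K →L[ℂ] K)) :
    traceClassElements ι τ π =
      Submodule.span ℂ {X | X ∈ tensorAlgebra ι π ∧ 0 ≤ X ∧ hatTrace τ π X < ∞} := by
  simp only [ContinuousLinearMap.nonneg_iff_isPositive]
  -- Membership in `tensorAlgebra` and in `spatialTensor` agree definitionally.
  rfl

theorem tensorTraceClass_subset (hτ : IsFaithfulTrace τ) (hπ : Function.Injective π) :
    tensorTraceClass ι τ π ⊆ traceClassElements ι τ π := by
  rintro X ⟨hX, hXY⟩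
  have hT := isConeTrace_hatTrace (ι := ι) hτ hπ
  -- One Y at finite trace distance is enough.
  obtain ⟨Y, hY, hlt⟩ := hXY 1 one_pos
  have hXm : X ∈ tensorAlgebra ι π := hX
  have hYm : Y ∈ tensorAlgebra ι π := algTensorTraceClass_le ι π hY
  obtain ⟨r, hr, hYr⟩ := exists_hasBound_of_mem_algTensorTraceClass hτ hπ hY
  have h1 := hasBound_of_trace_abs (isClosed_tensorAlgebra π) hT (sub_mem hXm hYm)
  have h2 : hatTrace τ π (absOp (X - Y)) < ∞ := hlt.trans ENNReal.ofReal_lt_top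
  have h3 := h1.add hT hYr
  rw [sub_add_cancel] at h3
  have := h3.mem_span hT hXm
    (ENNReal.add_lt_top.2 ⟨ENNReal.add_lt_top.2 ⟨h2, h2⟩, hr⟩)
  rwa [← traceClassElements_eq_span] at this

theorem block_sum {κ : Type*} (s : Finset κ) (X : κ → L2 ι K →L[ℂ] L2 ι K) (x y : ι) :
    block (∑ i ∈ s, X i) x y = ∑ i ∈ s, block (X i) x y :=
  map_sum (⟨⟨fun X => block X x y, rfl⟩, fun _ _ => rfl⟩ :
    (L2 ι K →L[ℂ] L2 ι K) →+ (K →L[ℂ] K)) X s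

theorem proj_mul_mul_proj_mem (hπ : Function.Injective π) {X : L2 ι K →L[ℂ] L2 ι K}
    (hX : X ∈ tensorAlgebra ι π) (F : Finset ι) :
    proj K F * X * proj K F ∈ algTensorTraceClass ι π := by
  have : proj K F * X * proj K F =
      ∑ x ∈ F, ∑ y ∈ F, tensorOp (π (entry π X x y)) (matrixUnit ℂ x y) := by
    refine block_ext fun z w => ?_
    simp only [block_sum, block_tensorOp, coef_matrixUnit, map_entry π hπ hX, block_mul_proj,
      block_proj_mul, ite_smul, one_smul, zero_smul]
    by_cases hz : z ∈ F <;> by_cases hw : w ∈ F <;>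
      simp [hz, hw]
  rw [this]
  exact sum_mem fun x _ => sum_mem fun y _ =>
    Submodule.subset_span ⟨_, _, isTraceClass_matrixUnit x y, rfl⟩

theorem exists_hasBound_sub_of_nonneg (hτ : IsFaithfulTrace τ) (hπ : Function.Injective π)
    {X : L2 ι K →L[ℂ] L2 ι K} (hX : X ∈ tensorAlgebra ι π) (h0 : 0 ≤ X)
    (hfin : hatTrace τ π X < ∞) {ε : ℝ} (hε : 0 < ε) :
    ∃ Y ∈ algTensorTraceClass ι π,
      HasBound (tensorAlgebra ι π) (hatTrace τ π) (X - Y) (ENNReal.ofReal ε) := by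
  have hT := isConeTrace_hatTrace (ι := ι) hτ hπ
  obtain ⟨R, hR, hRs, hRR⟩ := exists_star_mul_self_eq (isClosed_tensorAlgebra π) hX h0
  set t : ℝ := (hatTrace τ π X).toReal with ht
  have ht0 : 0 ≤ t := ENNReal.toReal_nonneg
  have htX : hatTrace τ π X = ENNReal.ofReal t := (ENNReal.ofReal_toReal hfin.ne).symm
  -- The total will be 2(st + s⁻¹q + q), with t the trace of X and q a bound for the trace of QXQ.
  -- Here st ≤ ε/4 and (s⁻¹ + 1)q = ε/4; the weight s is fixed before the finite set F is chosen.
  set s : ℝ := ε / (4 * (t + 1)) with hs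
  have hs0 : 0 < s := by positivity
  set q : ℝ := ε / (4 * (s⁻¹ + 1)) with hq
  have hq0 : 0 < q := by positivity
  have hlim := ENNReal.tendsto_tsum_compl_atTop_zero hfin.ne
  obtain ⟨F, hF⟩ := (hlim.eventually (ge_mem_nhds (ENNReal.ofReal_pos.2 hq0))).exists
  rw [← hatTrace_proj_mul_proj hπ hX F] at hF
  refine ⟨_, proj_mul_mul_proj_mem hπ hX F, ?_⟩
  set P := proj K F with hP
  have hPm : P ∈ tensorAlgebra ι π := proj_mem π F
  set Q := 1 - P with hQ
  have hQm : Q ∈ tensorAlgebra ι π := sub_mem (one_mem _) hPm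
  have hQs : star Q = Q := by rw [hQ, star_sub, star_one, hP, star_proj]
  -- This is QX + XQ − QXQ with X = R². Every product contains a factor QR or RQ, whose square has
  -- trace T(QXQ) ≤ q.
  have hsplit : X - P * X * P = (Q * R) * R + R * (R * Q) + (-(Q * R)) * (R * Q) := by
    have : X = R * R := hRR.symm
    rw [this, hQ]; noncomm_ring
  have e1 : star R * R = X := by rw [hRs, hRR]
  have e1' : R * star R = X := by rw [hRs, hRR]
  have e2 : (Q * R) * star (Q * R) = Q * X * Q := by
    rw [star_mul, hRs, hQs, ← hRR]; noncomm_ring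
  have e3 : star (R * Q) * (R * Q) = Q * X * Q := by
    rw [star_mul, hRs, hQs, ← hRR]; noncomm_ring
  have e4 : (-(Q * R)) * star (-(Q * R)) = Q * X * Q := by
    rw [star_neg, neg_mul_neg, e2]
  have b1 := hasBound_mul_of_pos hT (mul_mem hQm hR) hR hs0
  have b2 := hasBound_mul_of_pos hT hR (mul_mem hR hQm) (inv_pos.2 hs0)
  have b3 := HasBound.mul (T := hatTrace τ π) (neg_mem (mul_mem hQm hR)) (mul_mem hR hQm)
  rw [e1, e2] at b1
  rw [e1', e3, inv_inv] at b2
  rw [e3, e4] at b3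
  have b := (b1.add hT b2).add hT b3
  rw [← hsplit] at b
  refine b.mono ?_
  rw [htX]
  have hsi : 0 < s⁻¹ := inv_pos.2 hs0
  calc _ ≤ ENNReal.ofReal s * ENNReal.ofReal t + ENNReal.ofReal s⁻¹ * ENNReal.ofReal q
        + (ENNReal.ofReal s⁻¹ * ENNReal.ofReal q + ENNReal.ofReal s * ENNReal.ofReal t)
        + (ENNReal.ofReal q + ENNReal.ofReal q) := by gcongr
    _ = ENNReal.ofReal (s * t + s⁻¹ * q + (s⁻¹ * q + s * t) + (q + q)) := by
      rw [ENNReal.ofReal_add (by positivity) (by positivity),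
        ENNReal.ofReal_add (by positivity) (by positivity),
        ENNReal.ofReal_add (by positivity) (by positivity),
        ENNReal.ofReal_add (by positivity) (by positivity),
        ENNReal.ofReal_add (by positivity) (by positivity),
        ENNReal.ofReal_mul hs0.le, ENNReal.ofReal_mul hsi.le]
    _ ≤ ENNReal.ofReal ε := by
      refine ENNReal.ofReal_le_ofReal ?_
      have h1 : s * (t + 1) = ε / 4 := by rw [hs]; field_simp
      have h2 : q * (s⁻¹ + 1) = ε / 4 := by rw [hq]; field_simp
      nlinarith

theorem exists_hasBound_sub (hτ : IsFaithfulTrace τ) (hπ : Function.Injective π)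
    {X : L2 ι K →L[ℂ] L2 ι K} (hX : X ∈ traceClassElements ι τ π) {ε : ℝ} (hε : 0 < ε) :
    ∃ Y ∈ algTensorTraceClass ι π,
      HasBound (tensorAlgebra ι π) (hatTrace τ π) (X - Y) (ENNReal.ofReal ε) := by
  have hT := isConeTrace_hatTrace (ι := ι) hτ hπ
  rw [traceClassElements_eq_span] at hX
  induction hX using Submodule.span_induction generalizing ε with
  | mem X h => exact exists_hasBound_sub_of_nonneg hτ hπ h.1 h.2.1 h.2.2 hε
  | zero => exact ⟨0, zero_mem _, by rw [sub_zero]; exact hasBound_zero hτ hπ _⟩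
  | add X X' _ _ hX hX' =>
    obtain ⟨Y, hY, h⟩ := hX (half_pos hε)
    obtain ⟨Y', hY', h'⟩ := hX' (half_pos hε)
    refine ⟨Y + Y', add_mem hY hY', ?_⟩
    have := h.add hT h'
    rwa [← ENNReal.ofReal_add (half_pos hε).le (half_pos hε).le, add_halves, sub_add_sub_comm]
      at this
  | smul c X _ hX =>
    have hc : 0 < 1 + ‖c‖ ^ 2 := by positivity
    -- The divisor 1 + ‖c‖² is the loss in `HasBound.smul`.
    obtain ⟨Y, hY, h⟩ := hX (div_pos hε hc)
    refine ⟨c • Y, Submodule.smul_mem _ c hY, ?_⟩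
    have := h.smul hT c
    rwa [← ENNReal.ofReal_one, ← ENNReal.ofReal_add zero_le_one (sq_nonneg _),
      ← ENNReal.ofReal_mul hc.le, mul_div_cancel₀ _ hc.ne', smul_sub] at this

theorem traceClassElements_subset (hτ : IsFaithfulTrace τ) (hπ : Function.Injective π) :
    (traceClassElements ι τ π : Set (L2 ι K →L[ℂ] L2 ι K)) ⊆ tensorTraceClass ι τ π := by
  intro X hX
  have hXm : X ∈ spatialTensor ι π := by
    refine (Submodule.span_le (p := spatialTensor ι π)).2 ?_ hX
    exact fun X h => h.1
  refine ⟨hXm, fun ε hε => ?_⟩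
  obtain ⟨Y, hY, h⟩ := exists_hasBound_sub hτ hπ hX (half_pos hε)
  have hXa : X ∈ tensorAlgebra ι π := hXm
  have hYa : Y ∈ tensorAlgebra ι π := algTensorTraceClass_le ι π hY
  refine ⟨Y, hY, lt_of_le_of_lt (h.trace_abs_le (isClosed_tensorAlgebra π)
    (isConeTrace_hatTrace hτ hπ) (sub_mem hXa hYa)) ?_⟩
  exact (ENNReal.ofReal_lt_ofReal_iff hε).2 (half_lt_self hε)

end TraceClass

end SpatialTrace

end

theorem mainTheorem6 {A : Type*} [CStarAlgebra A] [TopologicalSpace.SeparableSpace A]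
    (τ : A →L[ℂ] ℂ) (hτ : SpatialTrace.IsFaithfulTrace τ)
    {K : Type*} [NormedAddCommGroup K] [InnerProductSpace ℂ K] [CompleteSpace K]
    (π : A →⋆ₐ[ℂ] (K →L[ℂ] K)) (hπ : Function.Injective π) (d : ℕ) :
    (SpatialTrace.traceClassElements (Fin d → ℤ) τ π :
        Set (SpatialTrace.L2 (Fin d → ℤ) K →L[ℂ] SpatialTrace.L2 (Fin d → ℤ) K)) =
      SpatialTrace.tensorTraceClass (Fin d → ℤ) τ π :=
  Set.Subset.antisymm (SpatialTrace.traceClassElements_subset hτ hπ)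
    (SpatialTrace.tensorTraceClass_subset hτ hπ)
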